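/- All manifolds are smooth, finite-dimensional, Hausdorff, second countable and without boundary. Let $(M,g^M)$, $(\mathcal X,g^{\mathcal X})$ and $(\mathcal V,g^{\mathcal V})$ be Riemannian manifolds, let $\psi:\mathcal X\to(0,+\infty)$ be smooth, and let $\mathcal X\times_\psi\mathcal V$ be the warped product, i.e. $\mathcal X\times\mathcal V$ with the metric $g^{\mathcal X}+\psi^2g^{\mathcal V}$; $\pi_{\mathcal X},\pi_{\mathcal V}$ denote the two projections. For an isometric immersion $\varphi:M\to\mathcal X\times_\psi\mathcal V$, $\mathcal S^\varphi$ is its second fundamental form and $\vec H^\varphi=\sum_i\mathcal S^\varphi(e_i,e_i)$ ($(e_i)$ a local orthonormal frame of $M$) its mean curvature vector. An *Omori–Yau pair (OY-pair) for the Hessian* on a Riemannian manifold $(N,g)$ is a pair of smooth functions $h:[0,+\infty)\to[0,+\infty)$ and $\gamma:N\to[0,+\infty)$ such that 1. $h(0)>0$ and $h'(t)\ge0$ for all $t\ge0$; 2. $\limsup_{t\to+\infty}t\,h(\sqrt t)/h(t)<+\infty$; 3. $\int_0^{+\infty}dt/\sqrt{h(t)}=+\infty$; 4. $\gamma$ is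 proper; 5. there is $c>0$ such that $|\mathrm{grad}\,\gamma|\le c\sqrt\gamma$ outside a compact subset of $N$; 6. there is $c'>0$ such that, outside a compact subset of $N$, $\mathrm{Hess}\,\gamma(e,e)\le c'\sqrt{\gamma\,h(\sqrt\gamma)}\;g(e,e)$ for all tangent vectors $e$. It is an *OY-pair for the Laplacian* if 1–5 hold together with 6'. there is $c'>0$ such that $\Delta\gamma\le c'\sqrt{\gamma\,h(\sqrt\gamma)}$ outside a compact subset of $N$, where $\Delta$ is the trace of the Hessian. **Theorem 3.3.** Let $\varphi:M\to\mathcal X\times_\psi\mathcal V$ be an isometric immersion, let $(h,\Gamma)$ be an OY-pair for the Hessian on $(\mathcal V,g^{\mathcal V})$, and set $\gamma=\Gamma\circ\pi_{\mathcal V}\circ\varphi$. Assume that (a) $\varphi$ is proper, and (b) $\pi_{\mathcal X}(\varphi(M))$ is contained in a compact subset of $\mathcal X$. Then: - if (c) there is $\alpha>0$ such that, outside a compact subset of $M$, $|\mathcal S^\varphi(e,e)|\le\alpha\sqrt{h(\sqrt\gamma)}\,|e|^2$ for all tangent vectors $e$ of $M$, then $(h,\gamma)$ is an OY-pair for the Hessian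 on $(M,g^M)$; - if (c') there is $\alpha>0$ such that $|\vec H^\varphi|\le\alpha\sqrt{h(\sqrt\gamma)}$ outside a compact subset of $M$, then $(h,\gamma)$ is an OY-pair for the Laplacian on $(M,g^M)$. -/

import Mathlib

open Set Filter Topology Manifold
open scoped ContDiff

set_option linter.unusedSectionVars false

noncomputable section

namespace WarpedOY

section Riemannian

variable {E : Type*} [NormedAddCommGroup E] [NormedSpace ℝ E]
  {H : Type*} [TopologicalSpace H] {I : ModelWithCorners ℝ E H}
  {M : Type*} [TopologicalSpace M] [ChartedSpace H M] [IsManifold I ∞ M]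
  {E' : Type*} [NormedAddCommGroup E'] [NormedSpace ℝ E']
  {H' : Type*} [TopologicalSpace H'] {I' : ModelWithCorners ℝ E' H'}
  {N : Type*} [TopologicalSpace N] [ChartedSpace H' N] [IsManifold I' ∞ N]

variable (I M) in
/-- A smooth Riemannian metric on the manifold `M`. -/
abbrev Metric : Type _ :=
  Bundle.ContMDiffRiemannianMetric I ∞ E (TangentSpace I : M → Type _)

/-- The pull-back `(u,w) ↦ B(Au, Aw)` of a bilinear form. -/
def pullForm {T T' : Type*} [AddCommGroup T] [Module ℝ T] [TopologicalSpace T]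
    [AddCommGroup T'] [Module ℝ T'] [TopologicalSpace T']
    (A : T →L[ℝ] T') (B : T' →L[ℝ] T' →L[ℝ] ℝ) : T →L[ℝ] T →L[ℝ] ℝ :=
  (ContinuousLinearMap.precomp ℝ A).comp (B.comp A)

/-- The norm of a tangent vector. -/
def tnorm (g : Metric I M) (p : M) (v : TangentSpace I p) : ℝ :=
  √(g.inner p v v)

/-- The musical isomorphism from `T_p^*M` to `T_pM`: the inverse of `v ↦ g(v, ·)`. -/
def sharp (g : Metric I M) (p : M) :
    (TangentSpace I p →L[ℝ] ℝ) →L[ℝ] TangentSpace I p :=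
  (g.inner p).inverse

/-- A positive definite bilinear form on a finite-dimensional space is invertible as a map
to the dual. -/
theorem isInvertible_of_pos {T : Type*} [NormedAddCommGroup T] [NormedSpace ℝ T]
    [FiniteDimensional ℝ T] (B : T →L[ℝ] T →L[ℝ] ℝ) (hB : ∀ v, v ≠ 0 → 0 < B v v) :
    B.IsInvertible := by
  have hinj : Function.Injective (B : T →ₗ[ℝ] (T →L[ℝ] ℝ)) := by
    rw [← LinearMap.ker_eq_bot, LinearMap.ker_eq_bot']
    intro v hv
    by_contra hne
    have h1 := hB v hne
    have h2 : B v = 0 := hv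
    simp [h2] at h1
  have hdim : Module.finrank ℝ T = Module.finrank ℝ (T →L[ℝ] ℝ) := by
    rw [← LinearEquiv.finrank_eq (LinearMap.toContinuousLinearMap (𝕜 := ℝ) (E := T) (F' := ℝ))]
    exact (Subspace.dual_finrank_eq).symm
  let e := LinearEquiv.ofInjectiveOfFinrankEq (B : T →ₗ[ℝ] (T →L[ℝ] ℝ)) hinj hdim
  exact ⟨e.toContinuousLinearEquiv, by ext v w; rfl⟩

theorem inner_sharp [FiniteDimensional ℝ E] (g : Metric I M) (p : M)
    (η : TangentSpace I p →L[ℝ] ℝ) : g.inner p (sharp g p η) = η := by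
  have h : ContinuousLinearMap.IsInvertible (M := TangentSpace I p)
      (M₂ := TangentSpace I p →L[ℝ] ℝ) (g.inner p) :=
    isInvertible_of_pos (T := E) (g.inner p) (g.pos p)
  exact ((h.inverse_apply_eq (x := sharp g p η) (y := η)).1 rfl).symm

/-- The gradient of `f`: `g(grad f, v) = df(v)`. -/
def grad (g : Metric I M) (f : M → ℝ) (p : M) : TangentSpace I p :=
  sharp g p (mfderiv I 𝓘(ℝ, ℝ) f p)

/-- The coordinate expression of the metric in the preferred chart at `p`. -/
def chartMetric (g : Metric I M) (p : M) (y : E) : E →L[ℝ] E →L[ℝ] ℝ :=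
  pullForm (T := TangentSpace 𝓘(ℝ, E) y) (mfderiv 𝓘(ℝ, E) I (extChartAt I p).symm y)
    (g.inner ((extChartAt I p).symm y))

/-- The Christoffel symbols at `p` of the Levi-Civita connection, in the preferred chart at `p`
(the chart through which `T_pM` is identified with the model space `E`), for a manifold without
boundary: `g(Γ(u,w),z) = (∂_u g(w,z) + ∂_w g(u,z) - ∂_z g(u,w)) / 2`.
Thus `∇_u W = ∂_u W + Γ(u, W)` at `p` in this chart. -/
def christoffel (g : Metric I M) (p : M) (u w : TangentSpace I p) : TangentSpace I p :=
  let D : E →L[ℝ] E →L[ℝ] E →L[ℝ] ℝ := fderiv ℝ (chartMetric g p) (extChartAt I p p)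
  sharp g p ((1 / 2 : ℝ) • (D u w + D w u - (D.flip u).flip w))

/-- The Hessian `∇df` at `p`, as a bilinear form:
`Hess f (u,w) = ∂_u ∂_w f - df(Γ(u,w))` in the preferred chart at `p`. -/
def Hess (g : Metric I M) (f : M → ℝ) (p : M) (u w : TangentSpace I p) : ℝ :=
  let F : E → ℝ := f ∘ (extChartAt I p).symm
  let D2 : E →L[ℝ] E →L[ℝ] ℝ := fderiv ℝ (fderiv ℝ F) (extChartAt I p p)
  let df : TangentSpace I p →L[ℝ] ℝ := mfderiv I 𝓘(ℝ, ℝ) f p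
  D2 u w - df (christoffel g p u w)

theorem exists_orthonormalBasis [FiniteDimensional ℝ E] (g : Metric I M) (p : M) :
    ∃ b : Module.Basis (Fin (Module.finrank ℝ E)) ℝ (TangentSpace I p),
      ∀ i j, g.inner p (b i) (b j) = if i = j then 1 else 0 := by
  let C : InnerProductSpace.Core ℝ (TangentSpace I p) := g.toRiemannianMetric.toCore p
  have key : ∃ b : Module.Basis (Fin (Module.finrank ℝ (TangentSpace I p))) ℝ (TangentSpace I p),
      ∀ i j, g.inner p (b i) (b j) = if i = j then 1 else 0 := by
    let n1 : NormedAddCommGroup (TangentSpace I p) := C.toNormedAddCommGroup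
    let n2 : InnerProductSpace ℝ (TangentSpace I p) := InnerProductSpace.ofCore C.toCore
    have : FiniteDimensional ℝ (TangentSpace I p) := inferInstanceAs (FiniteDimensional ℝ E)
    refine ⟨(stdOrthonormalBasis ℝ (TangentSpace I p)).toBasis, fun i j => ?_⟩
    have := orthonormal_iff_ite.1 (stdOrthonormalBasis ℝ (TangentSpace I p)).orthonormal i j
    rw [OrthonormalBasis.coe_toBasis]
    exact this
  exact key

/-- A `g`-orthonormal basis of `T_pM`. -/
def orthonormalBasis [FiniteDimensional ℝ E] (g : Metric I M) (p : M) :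
    Module.Basis (Fin (Module.finrank ℝ E)) ℝ (TangentSpace I p) :=
  (exists_orthonormalBasis g p).choose

/-- The trace `∑ B(e_i, e_i)` of a bilinear map over an orthonormal basis of `T_pM`
(its value does not depend on the basis when `B` is bilinear). -/
def metricTrace [FiniteDimensional ℝ E] (g : Metric I M) (p : M) {W : Type*} [AddCommMonoid W]
    (B : TangentSpace I p → TangentSpace I p → W) : W :=
  ∑ i, B (orthonormalBasis g p i) (orthonormalBasis g p i)

/-- The Laplacian, the trace of the Hessian. -/
def laplacian [FiniteDimensional ℝ E] (g : Metric I M) (f : M → ℝ) (p : M) : ℝ :=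
  metricTrace g p (Hess g f p)

/-- `φ : M → N` is an isometric immersion: smooth, and `g^M` is the pull-back of `g^N`
(injectivity of the differential follows, see `IsIsometricImmersion.injective`). -/
structure IsIsometricImmersion (gM : Metric I M) (gN : Metric I' N) (φ : M → N) : Prop where
  smooth : ContMDiff I I' ∞ φ
  isometric : ∀ (p : M) (u w : TangentSpace I p),
    gM.inner p u w = gN.inner (φ p) (mfderiv I I' φ p u) (mfderiv I I' φ p w)

theorem IsIsometricImmersion.injective {gM : Metric I M} {gN : Metric I' N} {φ : M → N}
    (hφ : IsIsometricImmersion gM gN φ) (p : M) : Function.Injective (mfderiv I I' φ p) := by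
  rw [injective_iff_map_eq_zero]
  intro v hv
  by_contra hne
  have h := gM.pos p v hne
  rw [hφ.isometric, hv] at h
  simp at h

/-- The component of `ξ ∈ T_{φ(p)}N` normal to the image of `dφ(p)`: one subtracts from `ξ` the
vector `dφ(t)`, where `t` is determined by `g(dφ(t), dφ(w)) = g(ξ, dφ(w))` for all `w ∈ T_pM`. -/
def normalPart (gN : Metric I' N) (φ : M → N) (p : M) (ξ : TangentSpace I' (φ p)) :
    TangentSpace I' (φ p) :=
  let A : TangentSpace I p →L[ℝ] TangentSpace I' (φ p) := mfderiv I I' φ p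
  let pull : TangentSpace I p →L[ℝ] TangentSpace I p →L[ℝ] ℝ :=
    pullForm A (gN.inner (φ p))
  ξ - A (pull.inverse ((gN.inner (φ p) ξ).comp A))

theorem normalPart_orthogonal [FiniteDimensional ℝ E] (gN : Metric I' N) (φ : M → N) (p : M)
    (hφ : Function.Injective (mfderiv I I' φ p)) (ξ : TangentSpace I' (φ p))
    (w : TangentSpace I p) :
    gN.inner (φ p) (normalPart (I := I) gN φ p ξ) (mfderiv I I' φ p w) = 0 := by
  let A : TangentSpace I p →L[ℝ] TangentSpace I' (φ p) := mfderiv I I' φ p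
  let pull : TangentSpace I p →L[ℝ] TangentSpace I p →L[ℝ] ℝ :=
    pullForm A (gN.inner (φ p))
  have h : ContinuousLinearMap.IsInvertible (M := TangentSpace I p)
      (M₂ := TangentSpace I p →L[ℝ] ℝ) pull := by
    refine isInvertible_of_pos (T := E) pull fun v hv => ?_
    refine gN.pos (φ p) (A v) fun h0 => hv ?_
    exact hφ (h0.trans (map_zero A).symm)
  have h1 := (h.inverse_apply_eq (x := pull.inverse ((gN.inner (φ p) ξ).comp A))
    (y := (gN.inner (φ p) ξ).comp A)).1 rfl
  have h2 := congrArg (fun L : TangentSpace I p →L[ℝ] ℝ => L w) h1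
  have h3 : gN.inner (φ p) ξ (A w) = gN.inner (φ p)
    (A (pull.inverse ((gN.inner (φ p) ξ).comp A))) (A w) := h2
  change gN.inner (φ p) (ξ - A (pull.inverse ((gN.inner (φ p) ξ).comp A))) (A w) = 0
  rw [map_sub, sub_apply, ← h3, sub_self]

/-- The second fundamental form of an immersion `φ : M → N` at `p`: the normal component of
`∇_u (dφ W)`, where `W` extends `w` with constant components in the preferred chart at `p`; in
the preferred charts at `p` and `φ(p)`,
`S(u,w) = (∂_u ∂_w φ + Γ(dφ(u), dφ(w)))^⊥`, with `Γ` the Christoffel symbols of `N`. -/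
def secondFundamentalForm (gN : Metric I' N) (φ : M → N) (p : M) (u w : TangentSpace I p) :
    TangentSpace I' (φ p) :=
  let Φ : E → E' := writtenInExtChartAt I I' p φ
  let D2 : E →L[ℝ] E →L[ℝ] E' := fderiv ℝ (fderiv ℝ Φ) (extChartAt I p p)
  let D2uw : TangentSpace I' (φ p) := D2 u w
  normalPart (I := I) gN φ p
    (D2uw + christoffel gN (φ p) (mfderiv I I' φ p u) (mfderiv I I' φ p w))

/-- The mean curvature vector (not normalized): the trace of the second fundamental form. -/
def meanCurvature [FiniteDimensional ℝ E] (gM : Metric I M) (gN : Metric I' N) (φ : M → N)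
    (p : M) : TangentSpace I' (φ p) :=
  metricTrace gM p (secondFundamentalForm (I := I) gN φ p)

/-- The conditions common to Omori-Yau pairs for the Hessian and for the Laplacian.
The function `h : [0,∞) → [0,∞)` is represented by a function on `ℝ`, of which only the values
on `[0,∞)` matter. -/
structure IsOYPrePair (g : Metric I M) (h : ℝ → ℝ) (γ : M → ℝ) : Prop where
  h_smooth : ContDiffOn ℝ ∞ h (Ici 0)
  h_nonneg : ∀ t, 0 ≤ t → 0 ≤ h t
  γ_smooth : ContMDiff I 𝓘(ℝ, ℝ) ∞ γ
  γ_nonneg : ∀ p, 0 ≤ γ p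
  h_zero : 0 < h 0
  h_deriv : ∀ t, 0 ≤ t → 0 ≤ derivWithin h (Ici 0) t
  h_limsup : limsup (fun t : ℝ => ((t * h (√t) / h t : ℝ) : EReal)) atTop < ⊤
  h_integral : ∫⁻ t in Ioi (0 : ℝ), ENNReal.ofReal (1 / √(h t)) = ⊤
  γ_proper : IsProperMap γ
  γ_grad : ∃ c : ℝ, 0 < c ∧ ∃ C : Set M, IsCompact C ∧
    ∀ p ∉ C, tnorm g p (grad g γ p) ≤ c * √(γ p)

/-- `(h,γ)` is an Omori-Yau pair for the Hessian on `(M,g)`. -/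
structure IsOYPairHessian (g : Metric I M) (h : ℝ → ℝ) (γ : M → ℝ) : Prop
    extends IsOYPrePair g h γ where
  γ_hess : ∃ c : ℝ, 0 < c ∧ ∃ C : Set M, IsCompact C ∧
    ∀ p ∉ C, ∀ e : TangentSpace I p,
      Hess g γ p e e ≤ c * √(γ p * h (√(γ p))) * g.inner p e e

/-- `(h,γ)` is an Omori-Yau pair for the Laplacian on `(M,g)`. -/
structure IsOYPairLaplacian [FiniteDimensional ℝ E] (g : Metric I M) (h : ℝ → ℝ) (γ : M → ℝ) :
    Prop extends IsOYPrePair g h γ where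
  γ_laplacian : ∃ c : ℝ, 0 < c ∧ ∃ C : Set M, IsCompact C ∧
    ∀ p ∉ C, laplacian g γ p ≤ c * √(γ p * h (√(γ p)))

end Riemannian

section Pullback

variable {E : Type*} [NormedAddCommGroup E] [NormedSpace ℝ E]
  {H : Type*} [TopologicalSpace H] {I : ModelWithCorners ℝ E H}
  {M : Type*} [TopologicalSpace M] [ChartedSpace H M] [IsManifold I ∞ M]
  {E' : Type*} [NormedAddCommGroup E'] [NormedSpace ℝ E']
  {H' : Type*} [TopologicalSpace H'] {I' : ModelWithCorners ℝ E' H'}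
  {N : Type*} [TopologicalSpace N] [ChartedSpace H' N] [IsManifold I' ∞ N]

/-- The pull-back of a metric tensor by a smooth map is a smooth tensor. -/
theorem contMDiff_pullback (g : Metric I' N) (f : M → N) (hf : ContMDiff I I' ∞ f) :
    ContMDiff I (I.prod 𝓘(ℝ, E →L[ℝ] E →L[ℝ] ℝ)) ∞
      (fun p => Bundle.TotalSpace.mk' (E →L[ℝ] E →L[ℝ] ℝ)
        (E := fun p : M => TangentSpace I p →L[ℝ] TangentSpace I p →L[ℝ] ℝ) p
        (pullForm (mfderiv I I' f p) (g.inner (f p)))) := by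
  intro p₀
  have h2 := (hf p₀).mfderiv_const (m := ∞) (by norm_num)
  rw [contMDiffAt_hom_bundle]
  refine ⟨contMDiffAt_id, ?_⟩
  have hg : ContMDiffAt I 𝓘(ℝ, E' →L[ℝ] E' →L[ℝ] ℝ) ∞
      (fun p => ContinuousLinearMap.inCoordinates E' (TangentSpace I' : N → Type _)
        (E' →L[ℝ] ℝ) (fun q : N => TangentSpace I' q →L[ℝ] Bundle.Trivial N ℝ q)
        (f p₀) (f p) (f p₀) (f p) (g.inner (f p))) p₀ := by
    have h1 := ((contMDiffAt_hom_bundle _).1 (g.contMDiff (f p₀))).2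
    exact h1.comp p₀ (hf p₀)
  have h3 := (h2.clm_precomp (F₃ := ℝ)).clm_comp (hg.clm_comp h2)
  refine h3.congr_of_eventuallyEq ?_
  have hb1 : ∀ᶠ p in 𝓝 p₀, p ∈ (trivializationAt E (TangentSpace I : M → Type _) p₀).baseSet :=
    (trivializationAt E (TangentSpace I : M → Type _) p₀).open_baseSet.mem_nhds
      (FiberBundle.mem_baseSet_trivializationAt' p₀)
  have hb2 : ∀ᶠ p in 𝓝 p₀,
      f p ∈ (trivializationAt E' (TangentSpace I' : N → Type _) (f p₀)).baseSet :=
    hf.continuous.continuousAt.preimage_mem_nhds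
      ((trivializationAt E' (TangentSpace I' : N → Type _) (f p₀)).open_baseSet.mem_nhds
      (FiberBundle.mem_baseSet_trivializationAt' (f p₀)))
  filter_upwards [hb1, hb2] with p hp hp'
  ext u w
  change ContinuousLinearMap.inCoordinates E (TangentSpace I : M → Type _)
        (E →L[ℝ] ℝ) (fun q : M => TangentSpace I q →L[ℝ] Bundle.Trivial M ℝ q)
        p₀ p p₀ p (pullForm (mfderiv I I' f p) (g.inner (f p))) u w
     = ContinuousLinearMap.inCoordinates E' (TangentSpace I' : N → Type _)
        (E' →L[ℝ] ℝ) (fun q : N => TangentSpace I' q →L[ℝ] Bundle.Trivial N ℝ q)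
        (f p₀) (f p) (f p₀) (f p) (g.inner (f p))
        (inTangentCoordinates I I' id f (fun p => mfderiv I I' f p) p₀ p u)
        (inTangentCoordinates I I' id f (fun p => mfderiv I I' f p) p₀ p w)
  rw [inCoordinates_apply_eq₂ hp hp (Set.mem_univ _),
    inCoordinates_apply_eq₂ hp' hp' (Set.mem_univ _)]
  have key : ∀ z : E, (trivializationAt E' (TangentSpace I' : N → Type _) (f p₀)).symm (f p)
      (inTangentCoordinates I I' id f (fun p => mfderiv I I' f p) p₀ p z)
      = mfderiv I I' f p
        ((trivializationAt E (TangentSpace I : M → Type _) p₀).symm p z) := by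
    intro z
    have h4 : inTangentCoordinates I I' id f (fun p => mfderiv I I' f p) p₀ p z
        = (trivializationAt E' (TangentSpace I' : N → Type _) (f p₀)).linearMapAt ℝ (f p)
          (mfderiv I I' f p
            ((trivializationAt E (TangentSpace I : M → Type _) p₀).symmL ℝ p z)) := rfl
    rw [h4, (trivializationAt E' (TangentSpace I' : N → Type _)
      (f p₀)).symm_linearMapAt (R := ℝ) hp', Bundle.Trivialization.symmL_apply _ hp]
  rw [key, key]
  rfl

end Pullback

section Warped

variable {E : Type*} [NormedAddCommGroup E] [NormedSpace ℝ E]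
  {H : Type*} [TopologicalSpace H] {I : ModelWithCorners ℝ E H}
  {X : Type*} [TopologicalSpace X] [ChartedSpace H X] [IsManifold I ∞ X]
  {E' : Type*} [NormedAddCommGroup E'] [NormedSpace ℝ E']
  {H' : Type*} [TopologicalSpace H'] {I' : ModelWithCorners ℝ E' H'}
  {V : Type*} [TopologicalSpace V] [ChartedSpace H' V] [IsManifold I' ∞ V]

theorem metric_nonneg (g : Metric I X) (p : X) (v : TangentSpace I p) : 0 ≤ g.inner p v v := by
  rcases eq_or_ne v 0 with rfl | hv
  · simp
  · exact (g.pos p v hv).le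

theorem metric_smul (g : Metric I X) (p : X) (c : ℝ) (v : TangentSpace I p) :
    g.inner p (c • v) (c • v) = c ^ 2 * g.inner p v v := by
  simp only [map_smul, smul_apply, smul_eq_mul]
  ring

/-- The warped product metric `g^X + ψ² g^V` on `X × V`. -/
def warpedMetric (gX : Metric I X) (gV : Metric I' V) (ψ : X → ℝ)
    (hψ : ContMDiff I 𝓘(ℝ, ℝ) ∞ ψ) (hψpos : ∀ x, 0 < ψ x) : Metric (I.prod I') (X × V) where
  inner q :=
    pullForm (mfderiv (I.prod I') I Prod.fst q) (gX.inner q.1)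
      + (ψ q.1) ^ 2 • pullForm (mfderiv (I.prod I') I' Prod.snd q) (gV.inner q.2)
  symm q v w := by
    have h1 := gX.symm q.1 (mfderiv (I.prod I') I Prod.fst q v)
      (mfderiv (I.prod I') I Prod.fst q w)
    have h2 := gV.symm q.2 (mfderiv (I.prod I') I' Prod.snd q v)
      (mfderiv (I.prod I') I' Prod.snd q w)
    exact congrArg₂ (fun a b : ℝ => a + (ψ q.1) ^ 2 * b) h1 h2
  pos q v hv := by
    have hψ2 : 0 < (ψ q.1) ^ 2 := pow_pos (hψpos q.1) 2
    change 0 < gX.inner q.1 (mfderiv (I.prod I') I Prod.fst q v)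
        (mfderiv (I.prod I') I Prod.fst q v)
      + (ψ q.1) ^ 2 * gV.inner q.2 (mfderiv (I.prod I') I' Prod.snd q v)
        (mfderiv (I.prod I') I' Prod.snd q v)
    rw [mfderiv_fst, mfderiv_snd]
    change 0 < gX.inner q.1 (show E × E' from v).1 (show E × E' from v).1
      + (ψ q.1) ^ 2 * gV.inner q.2 (show E × E' from v).2 (show E × E' from v).2
    rcases eq_or_ne (show E × E' from v).1 0 with h1 | h1
    · have h2 : (show E × E' from v).2 ≠ 0 := fun h2 => hv (Prod.ext h1 h2)
      have h3 := mul_pos hψ2 (gV.pos q.2 _ h2)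
      refine lt_of_lt_of_le h3 (le_add_of_nonneg_left ?_)
      exact metric_nonneg gX q.1 _
    · have h3 := gX.pos q.1 _ h1
      exact lt_of_lt_of_le h3 (le_add_of_nonneg_right
        (mul_nonneg hψ2.le (metric_nonneg gV q.2 _)))
  isVonNBounded q := by
    have hψ2 : 0 < (ψ q.1) ^ 2 := pow_pos (hψpos q.1) 2
    have hX := NormedSpace.isVonNBounded_iff ℝ (E := E) |>.1 (gX.isVonNBounded q.1)
    have hV := NormedSpace.isVonNBounded_iff ℝ (E := E') |>.1 (gV.isVonNBounded q.2)
    have hb := (hX.prod (hV.smul₀ (ψ q.1)⁻¹))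
    refine (NormedSpace.isVonNBounded_iff ℝ (E := E × E')).2 (hb.subset ?_)
    intro v hv
    have hv' : gX.inner q.1 (mfderiv (I.prod I') I Prod.fst q v)
        (mfderiv (I.prod I') I Prod.fst q v)
      + (ψ q.1) ^ 2 * gV.inner q.2 (mfderiv (I.prod I') I' Prod.snd q v)
        (mfderiv (I.prod I') I' Prod.snd q v) < 1 := hv
    rw [mfderiv_fst, mfderiv_snd] at hv'
    have hv2 : gX.inner q.1 v.1 v.1 + (ψ q.1) ^ 2 * gV.inner q.2 v.2 v.2 < 1 := hv'
    have n1 := metric_nonneg gX q.1 v.1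
    have n2 := mul_nonneg hψ2.le (metric_nonneg gV q.2 v.2)
    refine ⟨show gX.inner q.1 v.1 v.1 < 1 by linarith, ?_⟩
    refine ⟨ψ q.1 • v.2, ?_, inv_smul_smul₀ (hψpos q.1).ne' v.2⟩
    have h4 : gV.inner q.2 (ψ q.1 • v.2 : TangentSpace I' q.2) (ψ q.1 • v.2 : TangentSpace I' q.2)
        = (ψ q.1) ^ 2 * gV.inner q.2 v.2 v.2 := metric_smul gV q.2 (ψ q.1) v.2
    exact h4.trans_lt (by linarith)
  contMDiff := by
    have h1 := contMDiff_pullback gX (Prod.fst : X × V → X) (contMDiff_fst (I := I) (J := I'))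
    have h2 := contMDiff_pullback gV (Prod.snd : X × V → V) (contMDiff_snd (I := I) (J := I'))
    have h3 : ContMDiff (I.prod I') 𝓘(ℝ, ℝ) ∞ (fun q : X × V => (ψ q.1) ^ 2) :=
      (hψ.comp contMDiff_fst).pow 2
    exact h1.add_section (h3.smul_section h2)

end Warped

end WarpedOY

end

/-! Put `f = Γ ∘ Prod.snd` on the warped product, so that `γ = f ∘ φ`. Two formulas carry the proof.
For an isometric immersion, `IsIsometricImmersion.hess_comp` gives `Hess γ(e,e) = Hess f(dφ e, dφ e)
+ df(S(e,e))`. For a function lifted from the fibre, `hess_comp_snd` gives `Hess f(ξ,ξ) = Hess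
Γ(ξ_V,ξ_V) - (2/ψ) dψ(ξ_X) dΓ(ξ_V)`.

Over a compact set `K` containing the projection of `φ(M)`, `ψ ≥ s > 0` and `|dψ| ≤ L`. Since `|ξ_X|
≤ |ξ|` and `s |ξ_V| ≤ |ξ|`, the conditions on `Γ` give, off a compact set, `|df| ≤ (c/s) √Γ` and a
bound of `Hess f(ξ,ξ)` by a combination of `√(Γ h(√Γ)) |ξ|²` and `√Γ |ξ|²`. As `h` is nondecreasing
and `h(0) > 0`, the second is absorbed by the first (`IsOYPrePair.sqrt_le`). These estimates are
`exists_bounds`.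

The curvature term is at most `(c/s) √Γ |S(e,e)|`, and the growth allowed to `S` is exactly the
factor `√(h(√γ))` that turns `√Γ` into `√(Γ h(√Γ))`. For the Laplacian the same is done after taking
the trace, when the terms in `S` add up to `df` of the mean curvature. Properness holds because a
compact subset of the fibre, multiplied by `K`, has compact preimage under `φ`.

Connections are given by Christoffel symbols in preferred charts, so both formulas are reduced to
calculus in vector spaces: the behaviour of the Koszul expression under pull-back
(`koszul_pullback`) and the second-order chain rule (`fderiv_fderiv_comp`). -/

noncomputable section

namespace WarpedOY

/-! ### Calculus in vector spaces: Koszul expressions and second derivatives -/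

section Koszul

variable {E E' : Type*} [NormedAddCommGroup E] [NormedSpace ℝ E]
  [NormedAddCommGroup E'] [NormedSpace ℝ E']

/-- The Koszul expression `(D_u(w,z) + D_w(u,z) - D_z(u,w)) / 2` of a trilinear form, the
derivative of a metric. -/
def koszul (D : E →L[ℝ] E →L[ℝ] E →L[ℝ] ℝ) (u w z : E) : ℝ :=
  (1 / 2 : ℝ) * (D u w z + D w u z - D z u w)

theorem fderiv_apply_apply {G : E → E' →L[ℝ] E' →L[ℝ] ℝ} {y : E} (hG : DifferentiableAt ℝ G y)
    (a : E) (u w : E') : fderiv ℝ G y a u w = fderiv ℝ (fun x => G x u w) y a := by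
  have h := ((hG.hasFDerivAt.clm_apply (hasFDerivAt_const u y)).clm_apply
    (hasFDerivAt_const w y)).fderiv
  rw [h]
  simp

/-- Leibniz rule: one term comes from moving the base point of `G'`, and one from each of the two
slots. -/
theorem fderiv_pullback {Φ : E → E'} {G : E → E →L[ℝ] E →L[ℝ] ℝ} {G' : E' → E' →L[ℝ] E' →L[ℝ] ℝ}
    {y : E} (hG : DifferentiableAt ℝ G y) (hG' : DifferentiableAt ℝ G' (Φ y))
    (hΦ : ContDiffAt ℝ 2 Φ y)
    (h : ∀ᶠ x in 𝓝 y, ∀ u w, G x u w = G' (Φ x) (fderiv ℝ Φ x u) (fderiv ℝ Φ x w)) (a u w : E) :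
    fderiv ℝ G y a u w =
      fderiv ℝ G' (Φ y) (fderiv ℝ Φ y a) (fderiv ℝ Φ y u) (fderiv ℝ Φ y w)
      + G' (Φ y) (fderiv ℝ (fderiv ℝ Φ) y a u) (fderiv ℝ Φ y w)
      + G' (Φ y) (fderiv ℝ Φ y u) (fderiv ℝ (fderiv ℝ Φ) y a w) := by
  rw [fderiv_apply_apply hG]
  have h1 : (fun x => G x u w) =ᶠ[𝓝 y]
      fun x => G' (Φ x) (fderiv ℝ Φ x u) (fderiv ℝ Φ x w) := by
    filter_upwards [h] with x hx using hx u w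
  rw [h1.fderiv_eq]
  have hd : HasFDerivAt Φ (fderiv ℝ Φ y) y := (hΦ.differentiableAt (by norm_num)).hasFDerivAt
  have hd2 : HasFDerivAt (fderiv ℝ Φ) (fderiv ℝ (fderiv ℝ Φ) y) y :=
    ((hΦ.fderiv_right (m := 1) (by norm_num)).differentiableAt (by norm_num)).hasFDerivAt
  have hu : HasFDerivAt (fun x => fderiv ℝ Φ x u) ((fderiv ℝ (fderiv ℝ Φ) y).flip u) y := by
    simpa using hd2.clm_apply (hasFDerivAt_const u y)
  have hw : HasFDerivAt (fun x => fderiv ℝ Φ x w) ((fderiv ℝ (fderiv ℝ Φ) y).flip w) y := by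
    simpa using hd2.clm_apply (hasFDerivAt_const w y)
  have hc : HasFDerivAt (fun x => G' (Φ x)) ((fderiv ℝ G' (Φ y)).comp (fderiv ℝ Φ y)) y :=
    HasFDerivAt.comp (g := G') y hG'.hasFDerivAt hd
  rw [((hc.clm_apply hu).clm_apply hw).fderiv]
  simp
  ring

/-- The Koszul expression of a pulled back metric. -/
theorem koszul_pullback {Φ : E → E'} {G : E → E →L[ℝ] E →L[ℝ] ℝ}
    {G' : E' → E' →L[ℝ] E' →L[ℝ] ℝ}
    {y : E} (hG : DifferentiableAt ℝ G y) (hG' : DifferentiableAt ℝ G' (Φ y))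
    (hsymm : ∀ u w, G' (Φ y) u w = G' (Φ y) w u)
    (hΦ : ContDiffAt ℝ 2 Φ y)
    (h : ∀ᶠ x in 𝓝 y, ∀ u w, G x u w = G' (Φ x) (fderiv ℝ Φ x u) (fderiv ℝ Φ x w)) (u w z : E) :
    koszul (fderiv ℝ G y) u w z =
      koszul (fderiv ℝ G' (Φ y)) (fderiv ℝ Φ y u) (fderiv ℝ Φ y w) (fderiv ℝ Φ y z)
      + G' (Φ y) (fderiv ℝ (fderiv ℝ Φ) y u w) (fderiv ℝ Φ y z) := by
  have hs : ∀ a b, fderiv ℝ (fderiv ℝ Φ) y a b = fderiv ℝ (fderiv ℝ Φ) y b a := fun a b =>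
    hΦ.isSymmSndFDerivAt (by simp) a b
  simp only [koszul, fderiv_pullback hG hG' hΦ h]
  -- Of the six second-order terms, the symmetry of the second derivative and of `G'` makes four
  -- cancel in pairs; the other two are equal and absorb the factor 1/2.
  rw [hs w u, hs z u, hs z w, hsymm (fderiv ℝ Φ y u) (fderiv ℝ (fderiv ℝ Φ) y w z),
    hsymm (fderiv ℝ Φ y w) (fderiv ℝ (fderiv ℝ Φ) y u z)]
  ring

/-- The second derivative of a composition. -/
theorem fderiv_fderiv_comp {F : E' → ℝ} {Φ : E → E'} {y : E} (hF : ContDiffAt ℝ 2 F (Φ y))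
    (hΦ : ContDiffAt ℝ 2 Φ y) (u w : E) :
    fderiv ℝ (fderiv ℝ (F ∘ Φ)) y u w =
      fderiv ℝ (fderiv ℝ F) (Φ y) (fderiv ℝ Φ y u) (fderiv ℝ Φ y w)
      + fderiv ℝ F (Φ y) (fderiv ℝ (fderiv ℝ Φ) y u w) := by
  have hF1 : ∀ᶠ x in 𝓝 (Φ y), DifferentiableAt ℝ F x :=
    (hF.eventually (by simp)).mono fun x hx => hx.differentiableAt (by norm_num)
  have hΦ1 : ∀ᶠ x in 𝓝 y, DifferentiableAt ℝ Φ x :=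
    (hΦ.eventually (by simp)).mono fun x hx => hx.differentiableAt (by norm_num)
  have h1 : fderiv ℝ (F ∘ Φ) =ᶠ[𝓝 y] fun x => (fderiv ℝ F (Φ x)).comp (fderiv ℝ Φ x) := by
    filter_upwards [hΦ.continuousAt.eventually hF1, hΦ1] with x h1 h2 using fderiv_comp x h1 h2
  rw [h1.fderiv_eq]
  have hd : HasFDerivAt Φ (fderiv ℝ Φ y) y := (hΦ.differentiableAt (by norm_num)).hasFDerivAt
  have hd2 : HasFDerivAt (fderiv ℝ Φ) (fderiv ℝ (fderiv ℝ Φ) y) y :=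
    ((hΦ.fderiv_right (m := 1) (by norm_num)).differentiableAt (by norm_num)).hasFDerivAt
  have hd3 : HasFDerivAt (fderiv ℝ F) (fderiv ℝ (fderiv ℝ F) (Φ y)) (Φ y) :=
    ((hF.fderiv_right (m := 1) (by norm_num)).differentiableAt (by norm_num)).hasFDerivAt
  have h2 := ((hd3.comp y hd).clm_comp hd2).fderiv
  simp only [Function.comp_def] at h2
  rw [h2]
  simp
  ring

end Koszul

/-! ### The metric and its Christoffel symbols in the preferred chart -/

section Charts

variable {E : Type*} [NormedAddCommGroup E] [NormedSpace ℝ E]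
  {H : Type*} [TopologicalSpace H] {I : ModelWithCorners ℝ E H} [I.Boundaryless]
  {M : Type*} [TopologicalSpace M] [ChartedSpace H M] [IsManifold I ∞ M]
  {E' : Type*} [NormedAddCommGroup E'] [NormedSpace ℝ E']
  {H' : Type*} [TopologicalSpace H'] {I' : ModelWithCorners ℝ E' H'} [I'.Boundaryless]
  {N : Type*} [TopologicalSpace N] [ChartedSpace H' N] [IsManifold I' ∞ N]

theorem mfderiv_eq_fderiv_written {f : M → N} {p : M} (hf : MDifferentiableAt I I' f p) :
    mfderiv I I' f p = fderiv ℝ (writtenInExtChartAt I I' p f) (extChartAt I p p) := by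
  refine (if_pos hf).trans ?_
  change fderivWithin ℝ (writtenInExtChartAt I I' p f) (range I) (extChartAt I p p) = _
  rw [I.range_eq_univ, fderivWithin_univ]

/-- The tangent space at `p` is identified with `E` through this very chart, so no change of
coordinates appears at the centre. -/
theorem mfderiv_extChartAt_symm_self (p : M) :
    mfderiv 𝓘(ℝ, E) I (extChartAt I p).symm (extChartAt I p p) = ContinuousLinearMap.id ℝ E := by
  have h := mfderivWithin_range_extChartAt_symm (I := I) (x := p)
  rw [I.range_eq_univ, mfderivWithin_univ] at h
  exact h

theorem mdifferentiableAt_extChartAt_symm {p : M} {y : E} (hy : y ∈ (extChartAt I p).target) :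
    MDifferentiableAt 𝓘(ℝ, E) I (extChartAt I p).symm y := by
  have h := mdifferentiableWithinAt_extChartAt_symm (I := I) hy
  rwa [I.range_eq_univ, mdifferentiableWithinAt_univ] at h

theorem chartMetric_apply (g : Metric I M) (p : M) (y u w : E) :
    chartMetric g p y u w = g.inner ((extChartAt I p).symm y)
      (mfderiv 𝓘(ℝ, E) I (extChartAt I p).symm y u)
      (mfderiv 𝓘(ℝ, E) I (extChartAt I p).symm y w) := rfl

theorem chartMetric_self (g : Metric I M) (p : M) (u w : E) :
    chartMetric g p (extChartAt I p p) u w = g.inner p u w := by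
  rw [chartMetric_apply, mfderiv_extChartAt_symm_self]
  have h : (extChartAt I p).symm (extChartAt I p p) = p := extChartAt_to_inv p
  change (g.inner ((extChartAt I p).symm (extChartAt I p p)) : E →L[ℝ] E →L[ℝ] ℝ) u w
    = (g.inner p : E →L[ℝ] E →L[ℝ] ℝ) u w
  rw [h]

/-- Smoothness of the metric is smoothness of a section in the trivialization at `p`. The inverse of
the tangent bundle trivialization is the differential of the inverse chart, so this local expression
is `chartMetric` near the centre. -/
theorem contDiffAt_chartMetric (g : Metric I M) (p : M) :
    ContDiffAt ℝ ∞ (chartMetric g p) (extChartAt I p p) := by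
  have h1 := ((contMDiffAt_hom_bundle _).1 (g.contMDiff p)).2
  have h2 : ContMDiffAt 𝓘(ℝ, E) I ∞ (extChartAt I p).symm (extChartAt I p p) := by
    have := contMDiffWithinAt_extChartAt_symm_range (I := I) (n := ∞) p (mem_extChartAt_target p)
    rwa [I.range_eq_univ, contMDiffWithinAt_univ] at this
  -- The base point is written as the image of its coordinates, so that composition with the inverse
  -- chart applies.
  rw [← extChartAt_to_inv (I := I) p] at h1
  have h3 := (ContMDiffAt.comp (extChartAt I p p) h1 h2).contDiffAt
  refine h3.congr_of_eventuallyEq ?_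
  filter_upwards [extChartAt_target_mem_nhds (I := I) p] with y hy
  have hs : (extChartAt I p).symm y ∈ (chartAt H p).source := by
    rw [← extChartAt_source (I := I)]
    exact (extChartAt I p).map_target hy
  have hb : (extChartAt I p).symm y ∈
      (trivializationAt E (TangentSpace I : M → Type _) p).baseSet := hs
  have h4 := TangentBundle.symmL_trivializationAt (I := I) hs
  rw [I.range_eq_univ, mfderivWithin_univ, (extChartAt I p).right_inv hy] at h4
  ext u w
  rw [chartMetric_apply, ← h4]
  simp only [Function.comp_apply, extChartAt_to_inv]
  change _ = ContinuousLinearMap.inCoordinates E (TangentSpace I : M → Type _)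
        (E →L[ℝ] ℝ) (fun q : M => TangentSpace I q →L[ℝ] Bundle.Trivial M ℝ q)
        p ((extChartAt I p).symm y) p ((extChartAt I p).symm y)
        (g.inner ((extChartAt I p).symm y)) u w
  rw [inCoordinates_apply_eq₂ hb hb (Set.mem_univ _)]
  refine (congrArg₂ (fun a b => g.inner ((extChartAt I p).symm y) a b)
    (Bundle.Trivialization.symmL_apply (R := ℝ)
      (trivializationAt E (TangentSpace I : M → Type _) p) hb u)
    (Bundle.Trivialization.symmL_apply (R := ℝ)
      (trivializationAt E (TangentSpace I : M → Type _) p) hb w)).trans ?_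
  exact (congrArg (fun L : ℝ →ₗ[ℝ] ℝ => L (g.inner ((extChartAt I p).symm y) _ _))
    (Bundle.Trivial.linearMapAt_trivialization ℝ M ℝ _)).symm

theorem differentiableAt_chartMetric (g : Metric I M) (p : M) :
    DifferentiableAt ℝ (chartMetric g p) (extChartAt I p p) :=
  (contDiffAt_chartMetric g p).differentiableAt (by simp)

theorem inner_christoffel [FiniteDimensional ℝ E] (g : Metric I M) (p : M)
    (u w z : TangentSpace I p) :
    g.inner p (christoffel g p u w) z
      = koszul (fderiv ℝ (chartMetric g p) (extChartAt I p p)) u w z := by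
  exact congrArg (fun L : TangentSpace I p →L[ℝ] ℝ => L z) (inner_sharp g p _)

end Charts

/-! ### Gauss formula and the Hessian along an isometric immersion -/

section Immersion

variable {E : Type*} [NormedAddCommGroup E] [NormedSpace ℝ E]
  {H : Type*} [TopologicalSpace H] {I : ModelWithCorners ℝ E H} [I.Boundaryless]
  {M : Type*} [TopologicalSpace M] [ChartedSpace H M] [IsManifold I ∞ M]
  {E' : Type*} [NormedAddCommGroup E'] [NormedSpace ℝ E']
  {H' : Type*} [TopologicalSpace H'] {I' : ModelWithCorners ℝ E' H'} [I'.Boundaryless]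
  {N : Type*} [TopologicalSpace N] [ChartedSpace H' N] [IsManifold I' ∞ N]

/-- The differential of a function, as a linear form. -/
def differential (f : M → ℝ) (p : M) : TangentSpace I p →L[ℝ] ℝ := mfderiv I 𝓘(ℝ, ℝ) f p

/-- The second derivative of a map in the preferred charts. -/
def chartSecondDeriv (φ : M → N) (p : M) (u w : TangentSpace I p) : TangentSpace I' (φ p) :=
  (fderiv ℝ (fderiv ℝ (writtenInExtChartAt I I' p φ)) (extChartAt I p p) :
    E →L[ℝ] E →L[ℝ] E') u w

theorem contDiffAt_written {f : M → N} (hf : ContMDiff I I' ∞ f) (p : M) :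
    ContDiffAt ℝ ∞ (writtenInExtChartAt I I' p f) (extChartAt I p p) := by
  have h := (contMDiffAt_iff.1 (hf p)).2
  rwa [I.range_eq_univ, contDiffWithinAt_univ] at h

theorem written_self (f : M → N) (p : M) :
    writtenInExtChartAt I I' p f (extChartAt I p p) = extChartAt I' (f p) (f p) := by
  simp [writtenInExtChartAt]

theorem contDiffAt_comp_extChartAt_symm {f : M → ℝ} (hf : ContMDiff I 𝓘(ℝ, ℝ) ∞ f) (p : M) :
    ContDiffAt ℝ ∞ (f ∘ (extChartAt I p).symm) (extChartAt I p p) :=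
  contDiffAt_written hf p

/-- By continuity, `f` stays in the source of the chart at `f p`, where that chart can be inverted.
-/
theorem eventually_comp_extChartAt_symm {f : M → N} (hf : ContMDiff I I' ∞ f) (p : M) :
    ∀ᶠ y in 𝓝 (extChartAt I p p), f ((extChartAt I p).symm y) =
      (extChartAt I' (f p)).symm (writtenInExtChartAt I I' p f y) := by
  have h1 : ContinuousAt (fun y => f ((extChartAt I p).symm y)) (extChartAt I p p) := by
    refine ContinuousAt.comp' ?_ (continuousAt_extChartAt_symm p)
    exact hf.continuous.continuousAt
  have h2 : ∀ᶠ y in 𝓝 (extChartAt I p p),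
      f ((extChartAt I p).symm y) ∈ (extChartAt I' (f p)).source := by
    refine h1.eventually_mem ?_
    simp only [extChartAt_to_inv]
    exact extChartAt_source_mem_nhds (f p)
  filter_upwards [h2] with y hy
  exact ((extChartAt I' (f p)).left_inv hy).symm

theorem eventually_mfderiv_comp_extChartAt_symm {f : M → N} (hf : ContMDiff I I' ∞ f) (p : M) :
    ∀ᶠ y in 𝓝 (extChartAt I p p), ∀ u : E,
      (mfderiv I I' f ((extChartAt I p).symm y)
        (mfderiv 𝓘(ℝ, E) I (extChartAt I p).symm y u) : E') =
      mfderiv 𝓘(ℝ, E') I' (extChartAt I' (f p)).symm (writtenInExtChartAt I I' p f y)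
        (fderiv ℝ (writtenInExtChartAt I I' p f) y u) := by
  have hc := contDiffAt_written hf p
  have hd : ∀ᶠ y in 𝓝 (extChartAt I p p), DifferentiableAt ℝ (writtenInExtChartAt I I' p f) y :=
    ((hc.of_le (m := 1) (by norm_num)).eventually (by simp)).mono
      fun x hx => hx.differentiableAt (by norm_num)
  have ht : ∀ᶠ y in 𝓝 (extChartAt I p p),
      writtenInExtChartAt I I' p f y ∈ (extChartAt I' (f p)).target := by
    refine hc.continuousAt.eventually_mem ?_
    rw [written_self]
    exact extChartAt_target_mem_nhds (f p)
  -- The identity is needed on a neighbourhood of each nearby `y`, not only at `y`, because it is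
  -- differentiated there.
  filter_upwards [(eventually_comp_extChartAt_symm hf p).eventually_nhds, hd, ht,
    extChartAt_target_mem_nhds (I := I) p] with y h1 h2 h3 h4 u
  have e1 : mfderiv 𝓘(ℝ, E) I' (f ∘ (extChartAt I p).symm) y =
      (mfderiv I I' f ((extChartAt I p).symm y)).comp
        (mfderiv 𝓘(ℝ, E) I (extChartAt I p).symm y) :=
    mfderiv_comp y (hf.mdifferentiable (by simp) _) (mdifferentiableAt_extChartAt_symm h4)
  have e2 : mfderiv 𝓘(ℝ, E) I' ((extChartAt I' (f p)).symm ∘ writtenInExtChartAt I I' p f) y =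
      (mfderiv 𝓘(ℝ, E') I' (extChartAt I' (f p)).symm (writtenInExtChartAt I I' p f y)).comp
        (mfderiv 𝓘(ℝ, E) 𝓘(ℝ, E') (writtenInExtChartAt I I' p f) y) :=
    mfderiv_comp y (mdifferentiableAt_extChartAt_symm h3) h2.mdifferentiableAt
  have e3 : (mfderiv 𝓘(ℝ, E) I' (f ∘ (extChartAt I p).symm) y : E →L[ℝ] E') =
      mfderiv 𝓘(ℝ, E) I' ((extChartAt I' (f p)).symm ∘ writtenInExtChartAt I I' p f) y :=
    Filter.EventuallyEq.mfderiv_eq h1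
  rw [mfderiv_eq_fderiv] at e2
  have e4 := (e1.symm.trans e3).trans e2
  exact congrArg (fun L : E →L[ℝ] E' => L u) e4

/-- The isometry condition read in charts on a whole neighbourhood, which is what `koszul_pullback`
differentiates. -/
theorem IsIsometricImmersion.chartMetric_eq {gM : Metric I M} {gN : Metric I' N} {φ : M → N}
    (hφ : IsIsometricImmersion gM gN φ) (p : M) :
    ∀ᶠ y in 𝓝 (extChartAt I p p), ∀ u w : E, chartMetric gM p y u w =
      chartMetric gN (φ p) (writtenInExtChartAt I I' p φ y)
        (fderiv ℝ (writtenInExtChartAt I I' p φ) y u)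
        (fderiv ℝ (writtenInExtChartAt I I' p φ) y w) := by
  filter_upwards [eventually_comp_extChartAt_symm hφ.smooth p,
    eventually_mfderiv_comp_extChartAt_symm hφ.smooth p] with y h1 h2 u w
  refine (hφ.isometric _ _ _).trans ?_
  rw [chartMetric_apply]
  have h3 : (gN.inner (φ ((extChartAt I p).symm y)) : E' →L[ℝ] E' →L[ℝ] ℝ)
      = gN.inner ((extChartAt I' (φ p)).symm (writtenInExtChartAt I I' p φ y)) := by rw [h1]
  -- Tangent spaces at equal points are all the model space `E'`, so the comparison is one of
  -- bilinear forms on `E'`.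
  have h4 : ∀ (B B' : E' →L[ℝ] E' →L[ℝ] ℝ) (a a' b b' : E'), B = B' → a = a' → b = b' →
      B a b = B' a' b' := by
    rintro _ _ _ _ _ _ rfl rfl rfl
    rfl
  exact h4 _ _ _ _ _ _ h3 (h2 u) (h2 w)

/-- Gauss formula: the tangential part of the ambient derivative is the intrinsic one. -/
theorem IsIsometricImmersion.inner_christoffel_eq [FiniteDimensional ℝ E] [FiniteDimensional ℝ E']
    {gM : Metric I M} {gN : Metric I' N}
    {φ : M → N} (hφ : IsIsometricImmersion gM gN φ) (p : M) (u w z : TangentSpace I p) :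
    gM.inner p (christoffel gM p u w) z =
      gN.inner (φ p) (chartSecondDeriv (I := I) (I' := I') φ p u w +
        christoffel gN (φ p) (mfderiv I I' φ p u) (mfderiv I I' φ p w))
        (mfderiv I I' φ p z) := by
  have hd : ∀ v : TangentSpace I p, (mfderiv I I' φ p v : E') =
      fderiv ℝ (writtenInExtChartAt I I' p φ) (extChartAt I p p) v := fun v =>
    congrArg (fun L : E →L[ℝ] E' => L v)
      (mfderiv_eq_fderiv_written (hφ.smooth.mdifferentiable (by simp) p))
  have h1 := inner_christoffel gM p u w z
  have h2 := inner_christoffel gN (φ p) (mfderiv I I' φ p u) (mfderiv I I' φ p w)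
    (mfderiv I I' φ p z)
  have hG' : DifferentiableAt ℝ (chartMetric gN (φ p))
      (writtenInExtChartAt I I' p φ (extChartAt I p p)) := by
    rw [written_self]
    exact differentiableAt_chartMetric gN (φ p)
  have hs : ∀ a b : E', chartMetric gN (φ p) (writtenInExtChartAt I I' p φ (extChartAt I p p)) a b
      = gN.inner (φ p) a b := by
    intro a b
    rw [written_self]
    exact chartMetric_self gN (φ p) a b
  have h3 := koszul_pullback (differentiableAt_chartMetric gM p) hG'
    (fun a b => by
      rw [hs, hs]
      exact gN.symm (φ p) a b)
    ((contDiffAt_written hφ.smooth p).of_le (by norm_cast)) (hφ.chartMetric_eq p)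
    u w z
  refine (h1.trans h3).trans ?_
  rw [hs, written_self]
  have h4 : ∀ (B : E' →L[ℝ] E' →L[ℝ] ℝ) (a b c : E'), B (a + b) c = B b c + B a c := by
    intro B a b c
    rw [map_add, add_apply, add_comm]
  refine Eq.trans ?_ (h4 (gN.inner (φ p)) _ _ _).symm
  have h5 : ∀ a b c a' b' c' : E', a = a' → b = b' → c = c' →
      koszul (fderiv ℝ (chartMetric gN (φ p)) (extChartAt I' (φ p) (φ p))) a b c =
      koszul (fderiv ℝ (chartMetric gN (φ p)) (extChartAt I' (φ p) (φ p))) a' b' c' := by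
    rintro _ _ _ _ _ _ rfl rfl rfl
    rfl
  refine congrArg₂ (· + ·) ?_ ?_
  · exact (h5 _ _ _ _ _ _ (hd u).symm (hd w).symm (hd z).symm).trans h2.symm
  · exact congrArg (fun a : E' => (gN.inner (φ p) : E' →L[ℝ] E' →L[ℝ] ℝ) _ a) (hd z).symm

/-- By the Gauss formula, the Christoffel vector of `M` solves the equation that determines the
tangential part in `normalPart`, and the solution is unique because the pulled back form is positive
definite. -/
theorem IsIsometricImmersion.secondFundamentalForm_eq [FiniteDimensional ℝ E]
    [FiniteDimensional ℝ E'] {gM : Metric I M} {gN : Metric I' N}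
    {φ : M → N} (hφ : IsIsometricImmersion gM gN φ) (p : M) (u w : TangentSpace I p) :
    secondFundamentalForm (I := I) gN φ p u w =
      (chartSecondDeriv (I := I) (I' := I') φ p u w +
        christoffel gN (φ p) (mfderiv I I' φ p u) (mfderiv I I' φ p w))
      - mfderiv I I' φ p (christoffel gM p u w) := by
  have h : ContinuousLinearMap.IsInvertible (M := TangentSpace I p)
      (M₂ := TangentSpace I p →L[ℝ] ℝ) (pullForm (mfderiv I I' φ p) (gN.inner (φ p))) := by
    refine isInvertible_of_pos (T := E) _ fun v hv => ?_
    exact (gM.pos p v hv).trans_eq (hφ.isometric p v v)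
  have key : ∀ ξ : TangentSpace I' (φ p),
      (∀ z, gM.inner p (christoffel gM p u w) z = gN.inner (φ p) ξ (mfderiv I I' φ p z)) →
      normalPart (I := I) gN φ p ξ = ξ - mfderiv I I' φ p (christoffel gM p u w) := by
    intro ξ hξ
    have h1 := (h.inverse_apply_eq (x := christoffel gM p u w)
      (y := (gN.inner (φ p) ξ).comp (mfderiv I I' φ p))).2 (by
        ext z
        exact (hξ z).symm.trans (hφ.isometric p _ _))
    exact congrArg (fun v => ξ - mfderiv I I' φ p v) h1
  exact key _ (fun z => hφ.inner_christoffel_eq p u w z)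

/-- The Hessian of the restriction of a function to an isometrically immersed manifold. -/
theorem IsIsometricImmersion.hess_comp [FiniteDimensional ℝ E] [FiniteDimensional ℝ E']
    {gM : Metric I M} {gN : Metric I' N}
    {φ : M → N} (hφ : IsIsometricImmersion gM gN φ) {f : N → ℝ} (hf : ContMDiff I' 𝓘(ℝ, ℝ) ∞ f)
    (p : M) (u w : TangentSpace I p) :
    Hess gM (f ∘ φ) p u w =
      Hess gN f (φ p) (mfderiv I I' φ p u) (mfderiv I I' φ p w) +
        differential (I := I') f (φ p) (secondFundamentalForm (I := I) gN φ p u w) := by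
  have hd : ∀ v : E, (mfderiv I I' φ p v : E') =
      fderiv ℝ (writtenInExtChartAt I I' p φ) (extChartAt I p p) v := fun v =>
    congrArg (fun L : E →L[ℝ] E' => L v)
      (mfderiv_eq_fderiv_written (hφ.smooth.mdifferentiable (by simp) p))
  have hdf : ∀ v : E', (differential (I := I') f (φ p) v : ℝ) =
      fderiv ℝ (f ∘ (extChartAt I' (φ p)).symm) (extChartAt I' (φ p) (φ p)) v := fun v =>
    congrArg (fun L : E' →L[ℝ] ℝ => L v)
      (mfderiv_eq_fderiv_written (hf.mdifferentiable (by simp) (φ p)))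
  have h1 : (f ∘ φ) ∘ (extChartAt I p).symm =ᶠ[𝓝 (extChartAt I p p)]
      (f ∘ (extChartAt I' (φ p)).symm) ∘ writtenInExtChartAt I I' p φ := by
    filter_upwards [eventually_comp_extChartAt_symm hφ.smooth p] with y hy
    exact congrArg f hy
  have hF : ContDiffAt ℝ 2 (f ∘ (extChartAt I' (φ p)).symm)
      (writtenInExtChartAt I I' p φ (extChartAt I p p)) := by
    rw [written_self]
    exact (contDiffAt_comp_extChartAt_symm hf (φ p)).of_le (by norm_cast)
  have h2 := fderiv_fderiv_comp hF
    ((contDiffAt_written hφ.smooth p).of_le (by norm_cast)) u w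
  rw [← h1.fderiv.fderiv_eq, written_self] at h2
  replace h2 := h2.trans (congrArg₂ (· + ·) rfl (hdf _).symm)
  have h3 : (differential (I := I) (f ∘ φ) p : E →L[ℝ] ℝ) =
      (differential (I := I') f (φ p) : E' →L[ℝ] ℝ).comp (mfderiv I I' φ p : E →L[ℝ] E') :=
    mfderiv_comp p (hf.mdifferentiable (by simp) _) (hφ.smooth.mdifferentiable (by simp) _)
  have h5 : ∀ (L : E' →L[ℝ] ℝ) (a b c : E'), L (a + b - c) = L a + L b - L c := by
    intro L a b c
    rw [map_sub, map_add]
  have h6 : ∀ a b a' b' : E', a = a' → b = b' →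
      fderiv ℝ (fderiv ℝ (f ∘ (extChartAt I' (φ p)).symm)) (extChartAt I' (φ p) (φ p)) a b =
      fderiv ℝ (fderiv ℝ (f ∘ (extChartAt I' (φ p)).symm)) (extChartAt I' (φ p) (φ p)) a' b' := by
    rintro _ _ _ _ rfl rfl
    rfl
  have h7 := (congrArg (differential (I := I') f (φ p) : E' →L[ℝ] ℝ)
    (hφ.secondFundamentalForm_eq p u w)).trans (h5 _ _ _ _)
  have h8 := h6 _ _ _ _ (hd u) (hd w)
  have e1 : Hess gM (f ∘ φ) p u w =
    fderiv ℝ (fderiv ℝ ((f ∘ φ) ∘ (extChartAt I p).symm)) (extChartAt I p p) u w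
      - (differential (I := I) (f ∘ φ) p : E →L[ℝ] ℝ) (christoffel gM p u w) := rfl
  have e2 : Hess gN f (φ p) (mfderiv I I' φ p u) (mfderiv I I' φ p w) =
    fderiv ℝ (fderiv ℝ (f ∘ (extChartAt I' (φ p)).symm)) (extChartAt I' (φ p) (φ p))
      (mfderiv I I' φ p u) (mfderiv I I' φ p w)
      - (differential (I := I') f (φ p) : E' →L[ℝ] ℝ)
        (christoffel gN (φ p) (mfderiv I I' φ p u) (mfderiv I I' φ p w)) := rfl
  have h4 : ((differential (I := I) (f ∘ φ) p : E →L[ℝ] ℝ) (christoffel gM p u w) : ℝ) =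
      (differential (I := I') f (φ p) : E' →L[ℝ] ℝ)
        (mfderiv I I' φ p (christoffel gM p u w)) :=
    congrArg (fun L : E →L[ℝ] ℝ => L (christoffel gM p u w)) h3
  rw [e1, e2, h4]
  refine Eq.trans ?_ (congrArg₂ (· + ·) rfl h7.symm)
  -- The term `c`, the differential of `f` on the ambient Christoffel vector, is subtracted in the
  -- ambient Hessian and added back by the second fundamental form.
  have h9 : ∀ a b c d e d2 : ℝ, d2 = a + e → a = b → d2 - d = b - c + (e + c - d) := by
    intro a b c d e d2 k1 k2
    linarith
  exact h9 _ _ _ _ _ _ h2 h8.symm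

end Immersion

/-! ### Christoffel symbols and lifted functions on a warped product -/

section WarpedGeometry

variable {E : Type*} [NormedAddCommGroup E] [NormedSpace ℝ E]
  {H : Type*} [TopologicalSpace H] {I : ModelWithCorners ℝ E H} [I.Boundaryless]
  {X : Type*} [TopologicalSpace X] [ChartedSpace H X] [IsManifold I ∞ X]
  {E' : Type*} [NormedAddCommGroup E'] [NormedSpace ℝ E']
  {H' : Type*} [TopologicalSpace H'] {I' : ModelWithCorners ℝ E' H'} [I'.Boundaryless]
  {V : Type*} [TopologicalSpace V] [ChartedSpace H' V] [IsManifold I' ∞ V]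

theorem warpedMetric_apply (gX : Metric I X) (gV : Metric I' V) (ψ : X → ℝ)
    (hψ : ContMDiff I 𝓘(ℝ, ℝ) ∞ ψ) (hψpos : ∀ x, 0 < ψ x) (q : X × V) (a b : E × E') :
    (warpedMetric gX gV ψ hψ hψpos).inner q a b =
      gX.inner q.1 a.1 b.1 + ψ q.1 ^ 2 * gV.inner q.2 a.2 b.2 := by
  have h : ∀ (A : E × E' →L[ℝ] E) (B : E × E' →L[ℝ] E'),
      A = ContinuousLinearMap.fst ℝ E E' → B = ContinuousLinearMap.snd ℝ E E' →
      gX.inner q.1 (A a) (A b) + ψ q.1 ^ 2 * gV.inner q.2 (B a) (B b) =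
      gX.inner q.1 a.1 b.1 + ψ q.1 ^ 2 * gV.inner q.2 a.2 b.2 := by
    rintro _ _ rfl rfl
    rfl
  exact h _ _ (mfderiv_fst (I := I) (I' := I')) (mfderiv_snd (I := I) (I' := I'))

/-- The preferred chart of a product is the product of the preferred charts, so the differential of
its inverse splits into two blocks. -/
theorem chartMetric_warped (gX : Metric I X) (gV : Metric I' V) (ψ : X → ℝ)
    (hψ : ContMDiff I 𝓘(ℝ, ℝ) ∞ ψ) (hψpos : ∀ x, 0 < ψ x) (q : X × V) :
    ∀ᶠ y in 𝓝 (extChartAt (I.prod I') q q), ∀ u w : E × E',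
      chartMetric (warpedMetric gX gV ψ hψ hψpos) q y u w =
        chartMetric gX q.1 y.1 u.1 w.1 + ψ ((extChartAt I q.1).symm y.1) ^ 2 *
          chartMetric gV q.2 y.2 u.2 w.2 := by
  filter_upwards [extChartAt_target_mem_nhds (I := I.prod I') q] with y hy u w
  rw [extChartAt_prod] at hy
  have h1 : ((extChartAt (I.prod I') q).symm : E × E' → X × V) =
      Prod.map (extChartAt I q.1).symm (extChartAt I' q.2).symm := by
    rw [extChartAt_prod]
    rfl
  have h2 : ∀ a : E × E', (mfderiv 𝓘(ℝ, E × E') (I.prod I') (extChartAt (I.prod I') q).symm y a :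
      E × E') = (mfderiv 𝓘(ℝ, E) I (extChartAt I q.1).symm y.1 a.1,
        mfderiv 𝓘(ℝ, E') I' (extChartAt I' q.2).symm y.2 a.2) := by
    intro a
    rw [h1, modelWithCornersSelf_prod, ← chartedSpaceSelf_prod]
    exact congrArg (fun L : E × E' →L[ℝ] E × E' => L a)
      (mfderiv_prodMap (mdifferentiableAt_extChartAt_symm hy.1)
        (mdifferentiableAt_extChartAt_symm hy.2))
  rw [chartMetric_apply]
  refine (warpedMetric_apply gX gV ψ hψ hψpos _ _ _).trans ?_
  have h3 : ∀ (r : X × V) (a a' b b' : E × E'),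
      r = ((extChartAt I q.1).symm y.1, (extChartAt I' q.2).symm y.2) → a = a' → b = b' →
      (gX.inner r.1 a.1 b.1 + ψ r.1 ^ 2 * gV.inner r.2 a.2 b.2 : ℝ) =
      gX.inner ((extChartAt I q.1).symm y.1) a'.1 b'.1 +
        ψ ((extChartAt I q.1).symm y.1) ^ 2 *
          gV.inner ((extChartAt I' q.2).symm y.2) a'.2 b'.2 := by
    rintro _ _ _ _ _ rfl rfl rfl
    rfl
  exact h3 _ _ _ _ _ (congrFun h1 y) (h2 u) (h2 w)

theorem fderiv_warped {G : E × E' → E × E' →L[ℝ] E × E' →L[ℝ] ℝ}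
    {A : E → E →L[ℝ] E →L[ℝ] ℝ} {B : E' → E' →L[ℝ] E' →L[ℝ] ℝ} {P : E → ℝ} {y : E × E'}
    (hG : DifferentiableAt ℝ G y) (hA : DifferentiableAt ℝ A y.1) (hB : DifferentiableAt ℝ B y.2)
    (hP : DifferentiableAt ℝ P y.1)
    (h : ∀ᶠ x in 𝓝 y, ∀ u w, G x u w = A x.1 u.1 w.1 + P x.1 ^ 2 * B x.2 u.2 w.2)
    (a u w : E × E') :
    fderiv ℝ G y a u w = fderiv ℝ A y.1 a.1 u.1 w.1
      + 2 * P y.1 * fderiv ℝ P y.1 a.1 * B y.2 u.2 w.2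
      + P y.1 ^ 2 * fderiv ℝ B y.2 a.2 u.2 w.2 := by
  rw [fderiv_apply_apply hG]
  have h1 : (fun x => G x u w) =ᶠ[𝓝 y]
      fun x => A x.1 u.1 w.1 + P x.1 ^ 2 * B x.2 u.2 w.2 := by
    filter_upwards [h] with x hx using hx u w
  rw [h1.fderiv_eq]
  have dA : HasFDerivAt (fun x : E × E' => A x.1)
      ((fderiv ℝ A y.1).comp (ContinuousLinearMap.fst ℝ E E')) y :=
    HasFDerivAt.comp (g := A) y hA.hasFDerivAt (hasFDerivAt_fst (𝕜 := ℝ) (p := y))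
  have dB : HasFDerivAt (fun x : E × E' => B x.2)
      ((fderiv ℝ B y.2).comp (ContinuousLinearMap.snd ℝ E E')) y :=
    HasFDerivAt.comp (g := B) y hB.hasFDerivAt (hasFDerivAt_snd (𝕜 := ℝ) (p := y))
  have dP : HasFDerivAt (fun x : E × E' => P x.1)
      ((fderiv ℝ P y.1).comp (ContinuousLinearMap.fst ℝ E E')) y :=
    HasFDerivAt.comp (g := P) y hP.hasFDerivAt (hasFDerivAt_fst (𝕜 := ℝ) (p := y))
  have dA2 := (dA.clm_apply (hasFDerivAt_const u.1 y)).clm_apply (hasFDerivAt_const w.1 y)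
  have dB2 := (dB.clm_apply (hasFDerivAt_const u.2 y)).clm_apply (hasFDerivAt_const w.2 y)
  have hs := (dA2.fun_add ((dP.pow 2).fun_mul dB2)).fderiv
  rw [hs]
  simp
  ring

/-- A positive definite form is nondegenerate, so a vector is determined by its pairings. With `s`
the warping function and `r` its derivative, dividing by `s²` produces the coefficient `2r/s`. -/
theorem eq_add_smul_of_forall_apply {T : Type*} [NormedAddCommGroup T] [NormedSpace ℝ T]
    (B : T →L[ℝ] T →L[ℝ] ℝ) (hB : ∀ v, v ≠ 0 → 0 < B v v) {x c w : T} {s r : ℝ} (hs : s ≠ 0)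
    (h : ∀ z, s ^ 2 * B x z = s ^ 2 * B c z + 2 * s * r * B w z) :
    x = c + (2 / s * r) • w := by
  have hinj : ∀ v : T, (∀ z, B v z = 0) → v = 0 := by
    intro v hv
    by_contra hne
    exact (hB v hne).ne' (hv v)
  rw [← sub_eq_zero]
  apply hinj
  intro z
  rw [map_sub, map_add, map_smul]
  simp only [sub_apply, add_apply, smul_apply, smul_eq_mul]
  apply mul_left_cancel₀ (pow_ne_zero 2 hs)
  rw [mul_zero, mul_sub, mul_add, h z]
  field_simp
  ring

/-- The component along the fibre of the Christoffel symbols of a warped product. -/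
theorem christoffel_warped_snd [FiniteDimensional ℝ E] [FiniteDimensional ℝ E']
    (gX : Metric I X) (gV : Metric I' V) (ψ : X → ℝ)
    (hψ : ContMDiff I 𝓘(ℝ, ℝ) ∞ ψ) (hψpos : ∀ x, 0 < ψ x) (q : X × V) (a : TangentSpace I q.1)
    (b : TangentSpace I' q.2) :
    (christoffel (warpedMetric gX gV ψ hψ hψpos) q ((a, b) : E × E') ((a, b) : E × E') :
      TangentSpace I q.1 × TangentSpace I' q.2).2 =
      christoffel gV q.2 b b + (2 / ψ q.1 * differential (I := I) ψ q.1 a) • b := by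
  let ξ : E × E' := (a, b)
  let C : E × E' := christoffel (warpedMetric gX gV ψ hψ hψpos) q ξ ξ
  have hpos := hψpos q.1
  have hy : extChartAt (I.prod I') q q = (extChartAt I q.1 q.1, extChartAt I' q.2 q.2) := by
    rw [extChartAt_prod]
    rfl
  have hP : (ψ ∘ (extChartAt I q.1).symm) (extChartAt I q.1 q.1) = ψ q.1 := by simp
  have hdP : ∀ v : E, differential (I := I) ψ q.1 v =
      fderiv ℝ (ψ ∘ (extChartAt I q.1).symm) (extChartAt I q.1 q.1) v := fun v =>
    congrArg (fun L : E →L[ℝ] ℝ => L v)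
      (mfderiv_eq_fderiv_written (hψ.mdifferentiable (by simp) q.1))
  have hD := fderiv_warped (G := chartMetric (warpedMetric gX gV ψ hψ hψpos) q)
    (A := chartMetric gX q.1) (B := chartMetric gV q.2) (P := ψ ∘ (extChartAt I q.1).symm)
    (differentiableAt_chartMetric (warpedMetric gX gV ψ hψ hψpos) q)
    (by rw [hy]; exact differentiableAt_chartMetric gX q.1)
    (by rw [hy]; exact differentiableAt_chartMetric gV q.2)
    (by rw [hy]; exact (contDiffAt_comp_extChartAt_symm hψ q.1).differentiableAt (by simp))
    (chartMetric_warped gX gV ψ hψ hψpos q)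
  have hs : ∀ a b : E', chartMetric gV q.2 (extChartAt I' q.2 q.2) a b = gV.inner q.2 a b :=
    chartMetric_self gV q.2
  -- Pairing with vertical vectors `(0, z)` isolates the fibre component. Such vectors neither see
  -- the base metric nor differentiate `ψ`, so the only contribution of `ψ'` comes from the first
  -- two Koszul terms, which are equal.
  have key : ∀ z : E', ψ q.1 ^ 2 * (gV.inner q.2 : E' →L[ℝ] E' →L[ℝ] ℝ) C.2 z =
      ψ q.1 ^ 2 * (gV.inner q.2 : E' →L[ℝ] E' →L[ℝ] ℝ) (christoffel gV q.2 ξ.2 ξ.2) z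
        + 2 * ψ q.1 * differential (I := I) ψ q.1 ξ.1 *
          (gV.inner q.2 : E' →L[ℝ] E' →L[ℝ] ℝ) ξ.2 z := by
    intro z
    have h1 := inner_christoffel (warpedMetric gX gV ψ hψ hψpos) q ξ ξ ((0, z) : E × E')
    have h2 := warpedMetric_apply gX gV ψ hψ hψpos q C ((0, z) : E × E')
    have h3 : (gV.inner q.2 : E' →L[ℝ] E' →L[ℝ] ℝ) (christoffel gV q.2 ξ.2 ξ.2) z = _ :=
      inner_christoffel gV q.2 ξ.2 ξ.2 z
    have h4 := h2.symm.trans h1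
    have h5 : ((gX.inner q.1 : E →L[ℝ] E →L[ℝ] ℝ) C.1 0 : ℝ) = 0 := map_zero _
    have h6 : (gX.inner q.1 : E →L[ℝ] E →L[ℝ] ℝ) C.1 0
      + ψ q.1 ^ 2 * (gV.inner q.2 : E' →L[ℝ] E' →L[ℝ] ℝ) C.2 z =
      koszul (fderiv ℝ (chartMetric (warpedMetric gX gV ψ hψ hψpos) q)
        (extChartAt (I.prod I') q q)) ξ ξ (0, z) := h4
    rw [h5, zero_add] at h6
    rw [h6, h3, hdP]
    simp only [koszul, hD]
    rw [hy, hP, hs, hs]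
    simp
    ring
  exact eq_add_smul_of_forall_apply (T := E') (gV.inner q.2) (gV.pos q.2) hpos.ne' key

theorem differential_comp_snd {f : V → ℝ} (hf : ContMDiff I' 𝓘(ℝ, ℝ) ∞ f) (q : X × V)
    (ξ : E × E') : differential (I := I.prod I') (f ∘ Prod.snd) q ξ =
      differential (I := I') f q.2 ξ.2 := by
  have h : mfderiv (I.prod I') 𝓘(ℝ, ℝ) (f ∘ Prod.snd) q =
      (mfderiv I' 𝓘(ℝ, ℝ) f q.2).comp (mfderiv (I.prod I') I' Prod.snd q) :=
    mfderiv_comp q (hf.mdifferentiable (by simp) _) mdifferentiableAt_snd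
  rw [mfderiv_snd] at h
  exact congrArg (fun L : E × E' →L[ℝ] ℝ => L ξ) h

/-- The Hessian of a function lifted from the fibre of a warped product. -/
theorem hess_comp_snd [FiniteDimensional ℝ E] [FiniteDimensional ℝ E']
    (gX : Metric I X) (gV : Metric I' V) (ψ : X → ℝ)
    (hψ : ContMDiff I 𝓘(ℝ, ℝ) ∞ ψ) (hψpos : ∀ x, 0 < ψ x) {f : V → ℝ}
    (hf : ContMDiff I' 𝓘(ℝ, ℝ) ∞ f) (q : X × V) (ξ : E × E') :
    Hess (warpedMetric gX gV ψ hψ hψpos) (f ∘ Prod.snd) q ξ ξ =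
      Hess gV f q.2 ξ.2 ξ.2 - 2 / ψ q.1 * differential (I := I) ψ q.1 ξ.1 *
        differential (I := I') f q.2 ξ.2 := by
  have hy : extChartAt (I.prod I') q q = (extChartAt I q.1 q.1, extChartAt I' q.2 q.2) := by
    rw [extChartAt_prod]
    rfl
  have h1 : (f ∘ Prod.snd) ∘ (extChartAt (I.prod I') q).symm =
      (f ∘ (extChartAt I' q.2).symm) ∘ (Prod.snd : E × E' → E') := by
    rw [extChartAt_prod]
    rfl
  have hF : ContDiffAt ℝ 2 (f ∘ (extChartAt I' q.2).symm)
      ((Prod.snd : E × E' → E') (extChartAt (I.prod I') q q)) := by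
    rw [hy]
    exact (contDiffAt_comp_extChartAt_symm hf q.2).of_le (by norm_cast)
  have h2 := fderiv_fderiv_comp hF contDiffAt_snd ξ ξ
  -- The projection is linear: its second derivative vanishes, and so does the corresponding term of
  -- the chain rule.
  have h3 : fderiv ℝ (Prod.snd : E × E' → E') = fun _ => ContinuousLinearMap.snd ℝ E E' := by
    ext1 x
    exact fderiv_snd
  rw [← h1, h3] at h2
  simp only [fderiv_fun_const, Pi.zero_apply, ContinuousLinearMap.coe_snd',
    zero_apply, map_zero, add_zero] at h2
  rw [hy] at h2
  have e1 : Hess (warpedMetric gX gV ψ hψ hψpos) (f ∘ Prod.snd) q ξ ξ =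
    fderiv ℝ (fderiv ℝ ((f ∘ Prod.snd) ∘ (extChartAt (I.prod I') q).symm))
      (extChartAt (I.prod I') q q) ξ ξ -
      differential (I := I.prod I') (f ∘ Prod.snd) q
        (christoffel (warpedMetric gX gV ψ hψ hψpos) q ξ ξ) := rfl
  have e2 : Hess gV f q.2 ξ.2 ξ.2 = fderiv ℝ (fderiv ℝ (f ∘ (extChartAt I' q.2).symm))
      (extChartAt I' q.2 q.2) ξ.2 ξ.2 -
      differential (I := I') f q.2 (christoffel gV q.2 ξ.2 ξ.2) := rfl
  have h6 : ∀ (L : E' →L[ℝ] ℝ) (a b : E') (c : ℝ), L (a + c • b) = L a + c * L b := by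
    intro L a b c
    rw [map_add, map_smul, smul_eq_mul]
  -- The differential of the lifted function kills the base component of the Christoffel vector, so
  -- only its fibre component is needed.
  have h7 := (differential_comp_snd (I := I) hf q
    (christoffel (warpedMetric gX gV ψ hψ hψpos) q ξ ξ)).trans
    ((congrArg (differential (I := I') f q.2 : E' →L[ℝ] ℝ)
      (christoffel_warped_snd gX gV ψ hψ hψpos q ξ.1 ξ.2)).trans
        (h6 _ (christoffel gV q.2 ξ.2 ξ.2) ξ.2 _))
  rw [e1, e2, h7, hy, h2, sub_add_eq_sub_sub]
  rfl

end WarpedGeometry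

/-! ### Cauchy–Schwarz, gradients and bounds on compact sets -/

section Bounds

/-- Cauchy–Schwarz: `B(v + tw, v + tw)` is a nonnegative quadratic polynomial in `t`, so its
discriminant is nonpositive. -/
theorem sq_apply_le_of_symm {T : Type*} [NormedAddCommGroup T] [NormedSpace ℝ T]
    (B : T →L[ℝ] T →L[ℝ] ℝ) (hs : ∀ v w, B v w = B w v) (hB : ∀ v, 0 ≤ B v v) (v w : T) :
    B v w ^ 2 ≤ B v v * B w w := by
  have h : ∀ t : ℝ, 0 ≤ B w w * (t * t) + 2 * B v w * t + B v v := by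
    intro t
    have h1 := hB (v + t • w)
    simp only [map_add, map_smul, add_apply, smul_apply, smul_eq_mul, hs w v] at h1
    linarith
  have h2 := discrim_le_zero h
  rw [discrim] at h2
  linarith

theorem exists_coercive_of_pos {T : Type*} [NormedAddCommGroup T] [NormedSpace ℝ T]
    [FiniteDimensional ℝ T] (B : T →L[ℝ] T →L[ℝ] ℝ) (hB : ∀ v, v ≠ 0 → 0 < B v v) :
    ∃ c, 0 < c ∧ ∀ v, c * ‖v‖ ^ 2 ≤ B v v := by
  -- A positive lower bound on the unit sphere, extended by homogeneity; this form also covers an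
  -- empty sphere.
  obtain ⟨c, hc, h⟩ := (isCompact_sphere (0 : T) 1).exists_forall_le' (f := fun v => B v v)
    (a := 0) (by fun_prop) (fun v hv => hB v (by
      rintro rfl
      simp at hv))
  refine ⟨c, hc, fun v => ?_⟩
  rcases eq_or_ne v 0 with rfl | hv
  · simp
  have hn : 0 < ‖v‖ := norm_pos_iff.2 hv
  have h1 := h (‖v‖⁻¹ • v) (by simp [norm_smul, hn.ne'])
  simp only [map_smul, smul_apply, smul_eq_mul] at h1
  calc c * ‖v‖ ^ 2 ≤ (‖v‖⁻¹ * (‖v‖⁻¹ * B v v)) * ‖v‖ ^ 2 := by gcongr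
    _ = B v v := by field_simp

variable {E : Type*} [NormedAddCommGroup E] [NormedSpace ℝ E] [FiniteDimensional ℝ E]
  {H : Type*} [TopologicalSpace H] {I : ModelWithCorners ℝ E H}
  {M : Type*} [TopologicalSpace M] [ChartedSpace H M] [IsManifold I ∞ M]

theorem tnorm_nonneg (g : Metric I M) (p : M) (v : TangentSpace I p) : 0 ≤ tnorm g p v :=
  Real.sqrt_nonneg _

theorem tnorm_sq (g : Metric I M) (p : M) (v : TangentSpace I p) :
    tnorm g p v ^ 2 = g.inner p v v :=
  Real.sq_sqrt (metric_nonneg g p v)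

theorem abs_inner_le (g : Metric I M) (p : M) (v w : TangentSpace I p) :
    |g.inner p v w| ≤ tnorm g p v * tnorm g p w := by
  refine abs_le_of_sq_le_sq ?_ (mul_nonneg (tnorm_nonneg g p v) (tnorm_nonneg g p w))
  rw [mul_pow, tnorm_sq, tnorm_sq]
  exact sq_apply_le_of_symm (T := E) (g.inner p) (g.symm p) (metric_nonneg g p) v w

theorem inner_grad (g : Metric I M) (f : M → ℝ) (p : M) (v : TangentSpace I p) :
    g.inner p (grad g f p) v = differential (I := I) f p v :=
  congrArg (fun L : TangentSpace I p →L[ℝ] ℝ => L v) (inner_sharp g p _)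

theorem abs_differential_le (g : Metric I M) (f : M → ℝ) (p : M) (v : TangentSpace I p) :
    |differential (I := I) f p v| ≤ tnorm g p (grad g f p) * tnorm g p v := by
  rw [← inner_grad g]
  exact abs_inner_le g p _ _

/-- Testing on the gradient itself gives `|grad f|² ≤ c |grad f|`. -/
theorem tnorm_grad_le (g : Metric I M) (f : M → ℝ) (p : M) {c : ℝ} (hc : 0 ≤ c)
    (h : ∀ v : TangentSpace I p, |differential (I := I) f p v| ≤ c * tnorm g p v) :
    tnorm g p (grad g f p) ≤ c := by
  have h1 := (le_abs_self _).trans (h (grad g f p))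
  rw [← inner_grad g, ← tnorm_sq] at h1
  rcases (tnorm_nonneg g p (grad g f p)).eq_or_lt with h0 | h0
  · rw [← h0]
    exact hc
  · exact le_of_mul_le_mul_right (by linarith) h0

variable [I.Boundaryless]

/-- In the chart at `p` both sides vary continuously with the point: the coordinate derivative of
`f` stays bounded, and the metric stays uniformly comparable from below with the norm of `E`. -/
theorem eventually_abs_differential_le (g : Metric I M) {f : M → ℝ}
    (hf : ContMDiff I 𝓘(ℝ, ℝ) ∞ f) (p : M) :
    ∃ C : ℝ, ∀ᶠ x in 𝓝 p, ∀ v : TangentSpace I x,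
      |differential (I := I) f x v| ≤ C * tnorm g x v := by
  obtain ⟨c, hc, hcoer⟩ := exists_coercive_of_pos (T := E)
    (chartMetric g p (extChartAt I p p)) (fun v hv => by
      rw [chartMetric_self]
      exact g.pos p v hv)
  set F : E → ℝ := f ∘ (extChartAt I p).symm
  have hF := contDiffAt_comp_extChartAt_symm hf p
  have hF' : ContinuousAt (fderiv ℝ F) (extChartAt I p p) :=
    (hF.fderiv_right (m := 0) (by simp)).continuousAt
  have h1 : ∀ᶠ y in 𝓝 (extChartAt I p p), ‖fderiv ℝ F y‖ < ‖fderiv ℝ F (extChartAt I p p)‖ + 1 :=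
    hF'.norm.eventually_lt continuousAt_const (by linarith)
  -- A perturbation smaller than `c / 2` leaves half of the coercivity constant at `p`.
  have h2 : ∀ᶠ y in 𝓝 (extChartAt I p p),
      ‖chartMetric g p y - chartMetric g p (extChartAt I p p)‖ < c / 2 := by
    have h3 := (tendsto_iff_norm_sub_tendsto_zero (E := E →L[ℝ] E →L[ℝ] ℝ)).1
      (differentiableAt_chartMetric g p).continuousAt.tendsto
    exact h3.eventually_lt_const (by positivity)
  set L := ‖fderiv ℝ F (extChartAt I p p)‖ + 1
  have hLpos : 0 ≤ L := by positivity
  -- `L` bounds the coordinate derivative, and `√(2 / c)` converts the norm of `E` into the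
  -- Riemannian one.
  refine ⟨L * √(2 / c), ?_⟩
  have h3 : ∀ᶠ y in 𝓝 (extChartAt I p p), ∀ w : TangentSpace I ((extChartAt I p).symm y),
      |differential (I := I) f ((extChartAt I p).symm y) w| ≤
        L * √(2 / c) * tnorm g ((extChartAt I p).symm y) w := by
    filter_upwards [h1, h2, extChartAt_target_mem_nhds (I := I) p] with y h1 h2 hy w
    -- The differential of the inverse chart is onto, so every tangent vector near `p` has a
    -- coordinate vector.
    have hinv := isInvertible_mfderivWithin_extChartAt_symm (I := I) hy
    rw [I.range_eq_univ, mfderivWithin_univ] at hinv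
    obtain ⟨v, rfl⟩ : ∃ v : E, mfderiv 𝓘(ℝ, E) I (extChartAt I p).symm y v = w :=
      hinv.bijective.2 w
    have e1 : mfderiv 𝓘(ℝ, E) 𝓘(ℝ, ℝ) F y =
        (mfderiv I 𝓘(ℝ, ℝ) f ((extChartAt I p).symm y)).comp
          (mfderiv 𝓘(ℝ, E) I (extChartAt I p).symm y) :=
      mfderiv_comp y (hf.mdifferentiable (by simp) _) (mdifferentiableAt_extChartAt_symm hy)
    rw [mfderiv_eq_fderiv] at e1
    have e2 : fderiv ℝ F y v = differential (I := I) f ((extChartAt I p).symm y)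
        (mfderiv 𝓘(ℝ, E) I (extChartAt I p).symm y v) :=
      congrArg (fun A : E →L[ℝ] ℝ => A v) e1
    have e3 : tnorm g ((extChartAt I p).symm y) (mfderiv 𝓘(ℝ, E) I (extChartAt I p).symm y v) =
        √(chartMetric g p y v v) := rfl
    rw [← e2, e3]
    have e4 : c / 2 * ‖v‖ ^ 2 ≤ chartMetric g p y v v := by
      have k1 := hcoer v
      have k2 := (abs_le.1 (((chartMetric g p y -
        chartMetric g p (extChartAt I p p)).le_opNorm₂ v v))).1
      have k3 : ‖chartMetric g p y - chartMetric g p (extChartAt I p p)‖ * ‖v‖ * ‖v‖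
          ≤ c / 2 * ‖v‖ * ‖v‖ := by gcongr
      simp only [sub_apply] at k2
      nlinarith
    have e5 : ‖v‖ ≤ √(2 / c) * √(chartMetric g p y v v) := by
      rw [← Real.sqrt_mul (by positivity)]
      apply Real.le_sqrt_of_sq_le
      calc ‖v‖ ^ 2 = 2 / c * (c / 2 * ‖v‖ ^ 2) := by field_simp
        _ ≤ _ := by gcongr
    calc |fderiv ℝ F y v| ≤ ‖fderiv ℝ F y‖ * ‖v‖ := (fderiv ℝ F y).le_opNorm v
      _ ≤ L * (√(2 / c) * √(chartMetric g p y v v)) := by gcongr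
      _ = _ := by ring
  have h4 := (continuousAt_extChartAt (I := I) p).eventually h3
  filter_upwards [h4, extChartAt_source_mem_nhds (I := I) p] with x hx hxs
  rwa [(extChartAt I p).left_inv hxs] at hx

theorem exists_abs_differential_le_of_isCompact (g : Metric I M) {f : M → ℝ}
    (hf : ContMDiff I 𝓘(ℝ, ℝ) ∞ f) {K : Set M} (hK : IsCompact K) :
    ∃ C : ℝ, 0 ≤ C ∧ ∀ x ∈ K, ∀ v : TangentSpace I x,
      |differential (I := I) f x v| ≤ C * tnorm g x v := by
  refine hK.induction_on (p := fun S => ∃ C : ℝ, 0 ≤ C ∧ ∀ x ∈ S, ∀ v : TangentSpace I x,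
      |differential (I := I) f x v| ≤ C * tnorm g x v) ⟨0, le_rfl, by simp⟩ ?_ ?_ ?_
  · rintro s t hst ⟨C, hC, h⟩
    exact ⟨C, hC, fun x hx => h x (hst hx)⟩
  · rintro s t ⟨C, hC, h⟩ ⟨D, hD, k⟩
    refine ⟨max C D, le_max_of_le_left hC, ?_⟩
    rintro x (hx | hx) v
    · exact (h x hx v).trans
        (mul_le_mul_of_nonneg_right (le_max_left _ _) (tnorm_nonneg g x v))
    · exact (k x hx v).trans
        (mul_le_mul_of_nonneg_right (le_max_right _ _) (tnorm_nonneg g x v))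
  · intro x _
    obtain ⟨C, hC⟩ := eventually_abs_differential_le g hf x
    refine ⟨_, mem_nhdsWithin_of_mem_nhds hC, max C 0, le_max_right _ _, fun y hy v => ?_⟩
    exact (hy v).trans (mul_le_mul_of_nonneg_right (le_max_left _ _) (tnorm_nonneg g y v))

end Bounds

/-! ### Estimates for a function lifted from the fibre -/

section WarpedBounds

variable {E : Type*} [NormedAddCommGroup E] [NormedSpace ℝ E] [FiniteDimensional ℝ E]
  {H : Type*} [TopologicalSpace H] {I : ModelWithCorners ℝ E H} [I.Boundaryless]
  {X : Type*} [TopologicalSpace X] [ChartedSpace H X] [IsManifold I ∞ X]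
  {E' : Type*} [NormedAddCommGroup E'] [NormedSpace ℝ E'] [FiniteDimensional ℝ E']
  {H' : Type*} [TopologicalSpace H'] {I' : ModelWithCorners ℝ E' H'} [I'.Boundaryless]
  {V : Type*} [TopologicalSpace V] [ChartedSpace H' V] [IsManifold I' ∞ V]
  (gX : Metric I X) (gV : Metric I' V) (ψ : X → ℝ)
  (hψ : ContMDiff I 𝓘(ℝ, ℝ) ∞ ψ) (hψpos : ∀ x, 0 < ψ x)

theorem tnorm_fst_le (q : X × V) (ξ : E × E') :
    tnorm gX q.1 ξ.1 ≤ tnorm (warpedMetric gX gV ψ hψ hψpos) q ξ := by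
  refine Real.sqrt_le_sqrt ?_
  rw [warpedMetric_apply]
  have := metric_nonneg gV q.2 ξ.2
  exact le_add_of_nonneg_right (mul_nonneg (sq_nonneg _) this)

theorem mul_tnorm_snd_le (q : X × V) (ξ : E × E') :
    ψ q.1 * tnorm gV q.2 ξ.2 ≤ tnorm (warpedMetric gX gV ψ hψ hψpos) q ξ := by
  refine Real.le_sqrt_of_sq_le ?_
  rw [warpedMetric_apply, mul_pow]
  have h : tnorm gV q.2 ξ.2 ^ 2 = gV.inner q.2 ξ.2 ξ.2 := tnorm_sq gV q.2 ξ.2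
  rw [h]
  exact le_add_of_nonneg_left (metric_nonneg gX q.1 ξ.1)

/-- Only the vertical component of `ξ` contributes, and its length in the fibre is at most `|ξ| / ψ
≤ |ξ| / s`. -/
theorem abs_differential_comp_snd_le {f : V → ℝ} (hf : ContMDiff I' 𝓘(ℝ, ℝ) ∞ f) {q : X × V}
    {c s : ℝ} (hs : 0 < s) (hsψ : s ≤ ψ q.1) (hc : 0 ≤ c)
    (hgrad : tnorm gV q.2 (grad gV f q.2) ≤ c) (ξ : E × E') :
    |differential (I := I.prod I') (f ∘ Prod.snd) q ξ| ≤
      c / s * tnorm (warpedMetric gX gV ψ hψ hψpos) q ξ := by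
  rw [differential_comp_snd hf]
  have h0 := tnorm_nonneg gV q.2 ξ.2
  have h1 : s * tnorm gV q.2 ξ.2 ≤ tnorm (warpedMetric gX gV ψ hψ hψpos) q ξ :=
    (mul_le_mul_of_nonneg_right hsψ h0).trans (mul_tnorm_snd_le gX gV ψ hψ hψpos q ξ)
  calc |differential (I := I') f q.2 ξ.2| ≤ _ := abs_differential_le gV f q.2 ξ.2
    _ ≤ c * tnorm gV q.2 ξ.2 := mul_le_mul_of_nonneg_right hgrad h0
    _ = c / s * (s * tnorm gV q.2 ξ.2) := by field_simp
    _ ≤ _ := mul_le_mul_of_nonneg_left h1 (by positivity)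

/-- In `hess_comp_snd` the fibre Hessian is quadratic in the vertical component, whence `b / s²`.
The cross term is bounded by the product of `2 / s`, `L |ξ|` and `(c / s) |ξ|`. -/
theorem hess_comp_snd_le {f : V → ℝ} (hf : ContMDiff I' 𝓘(ℝ, ℝ) ∞ f) {q : X × V}
    {b c L s : ℝ} (hs : 0 < s) (hsψ : s ≤ ψ q.1) (hc : 0 ≤ c) (hb : 0 ≤ b) (hL : 0 ≤ L)
    (hψL : ∀ v : TangentSpace I q.1, |differential (I := I) ψ q.1 v| ≤ L * tnorm gX q.1 v)
    (hgrad : tnorm gV q.2 (grad gV f q.2) ≤ c)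
    (hhess : ∀ e : TangentSpace I' q.2, Hess gV f q.2 e e ≤ b * gV.inner q.2 e e) (ξ : E × E') :
    Hess (warpedMetric gX gV ψ hψ hψpos) (f ∘ Prod.snd) q ξ ξ ≤
      (b / s ^ 2 + 2 * L * c / s ^ 2) * tnorm (warpedMetric gX gV ψ hψ hψpos) q ξ ^ 2 := by
  rw [hess_comp_snd gX gV ψ hψ hψpos hf]
  have h0 := tnorm_nonneg gV q.2 ξ.2
  set n := tnorm (warpedMetric gX gV ψ hψ hψpos) q ξ
  have hn0 : 0 ≤ n := tnorm_nonneg _ _ _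
  have h1 : s * tnorm gV q.2 ξ.2 ≤ n :=
    (mul_le_mul_of_nonneg_right hsψ h0).trans (mul_tnorm_snd_le gX gV ψ hψ hψpos q ξ)
  have h2 : Hess gV f q.2 ξ.2 ξ.2 ≤ b / s ^ 2 * n ^ 2 := by
    refine (hhess ξ.2).trans ?_
    refine (congrArg (b * ·) (tnorm_sq gV q.2 ξ.2)).symm.trans_le ?_
    calc b * tnorm gV q.2 ξ.2 ^ 2 = b / s ^ 2 * (s * tnorm gV q.2 ξ.2) ^ 2 := by field_simp
      _ ≤ _ := by gcongr
  have h3 : |differential (I := I) ψ q.1 ξ.1| ≤ L * n :=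
    (hψL ξ.1).trans (mul_le_mul_of_nonneg_left (tnorm_fst_le gX gV ψ hψ hψpos q ξ) hL)
  have h4 : |differential (I := I') f q.2 ξ.2| ≤ c / s * n := by
    have := abs_differential_comp_snd_le gX gV ψ hψ hψpos hf hs hsψ hc hgrad ξ
    rwa [differential_comp_snd hf] at this
  have h5 : 2 / ψ q.1 ≤ 2 / s := by gcongr
  have h6 : |2 / ψ q.1 * differential (I := I) ψ q.1 ξ.1 * differential (I := I') f q.2 ξ.2| ≤
      2 * L * c / s ^ 2 * n ^ 2 := by
    rw [abs_mul, abs_mul, abs_of_pos (div_pos two_pos (hψpos q.1))]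
    calc _ ≤ 2 / s * (L * n) * (c / s * n) := by gcongr
      _ = _ := by field_simp
  have h7 := (abs_le.1 h6).1
  linarith

end WarpedBounds

/-! ### Consequences of the conditions on `h`; orthonormal bases -/

section OYPair

variable {E : Type*} [NormedAddCommGroup E] [NormedSpace ℝ E]
  {H : Type*} [TopologicalSpace H] {I : ModelWithCorners ℝ E H}
  {M : Type*} [TopologicalSpace M] [ChartedSpace H M] [IsManifold I ∞ M]

theorem IsOYPrePair.zero_le_apply {g : Metric I M} {h : ℝ → ℝ} {γ : M → ℝ}
    (hp : IsOYPrePair g h γ) {t : ℝ} (ht : 0 ≤ t) : h 0 ≤ h t := by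
  have hmono : MonotoneOn h (Ici 0) := by
    refine monotoneOn_of_deriv_nonneg (convex_Ici 0) hp.h_smooth.continuousOn ?_ ?_
    · exact (hp.h_smooth.differentiableOn (by simp)).mono interior_subset
    · intro x hx
      rw [interior_Ici] at hx
      rw [← derivWithin_of_mem_nhds (Ici_mem_nhds hx)]
      exact hp.h_deriv x (le_of_lt hx)
  exact hmono self_mem_Ici ht ht

/-- Since `h(√t) ≥ h(0) > 0`, terms of order `√γ`, such as those coming from the gradient, are
absorbed in the growth `√(γ h(√γ))` permitted to the Hessian. -/
theorem IsOYPrePair.sqrt_le {g : Metric I M} {h : ℝ → ℝ} {γ : M → ℝ}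
    (hp : IsOYPrePair g h γ) {t : ℝ} (ht : 0 ≤ t) :
    √t ≤ √(t * h √t) / √(h 0) := by
  rw [← Real.sqrt_div' _ hp.h_zero.le]
  refine Real.sqrt_le_sqrt ?_
  rw [le_div_iff₀ hp.h_zero]
  exact mul_le_mul_of_nonneg_left (hp.zero_le_apply (Real.sqrt_nonneg t)) ht

theorem orthonormalBasis_inner [FiniteDimensional ℝ E] (g : Metric I M) (p : M)
    (i : Fin (Module.finrank ℝ E)) :
    g.inner p (orthonormalBasis g p i) (orthonormalBasis g p i) = 1 := by
  have h := (exists_orthonormalBasis g p).choose_spec i i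
  rwa [if_pos rfl] at h

end OYPair

/-! ### The pair `(h, γ)` on the immersed manifold -/

section Submanifold

variable {EM EX EV : Type*}
  [NormedAddCommGroup EM] [NormedSpace ℝ EM] [FiniteDimensional ℝ EM]
  [NormedAddCommGroup EX] [NormedSpace ℝ EX] [FiniteDimensional ℝ EX]
  [NormedAddCommGroup EV] [NormedSpace ℝ EV] [FiniteDimensional ℝ EV]
  {HM HX HV : Type*} [TopologicalSpace HM] [TopologicalSpace HX] [TopologicalSpace HV]
  {IM : ModelWithCorners ℝ EM HM} {IX : ModelWithCorners ℝ EX HX} {IV : ModelWithCorners ℝ EV HV}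
  [IM.Boundaryless] [IX.Boundaryless] [IV.Boundaryless]
  {M X V : Type*}
  [TopologicalSpace M] [ChartedSpace HM M] [IsManifold IM ∞ M]
  [TopologicalSpace X] [ChartedSpace HX X] [IsManifold IX ∞ X] [T2Space X]
  [TopologicalSpace V] [ChartedSpace HV V] [IsManifold IV ∞ V]
  {gM : Metric IM M} {gX : Metric IX X} {gV : Metric IV V}
  {ψ : X → ℝ} {hψ : ContMDiff IX 𝓘(ℝ, ℝ) ∞ ψ} {hψpos : ∀ x, 0 < ψ x}
  {φ : M → X × V} {h : ℝ → ℝ} {Γ : V → ℝ} {K : Set X}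

theorem tnorm_mfderiv (hφ : IsIsometricImmersion gM (warpedMetric gX gV ψ hψ hψpos) φ) (p : M)
    (v : TangentSpace IM p) :
    tnorm (warpedMetric gX gV ψ hψ hψpos) (φ p) (mfderiv IM (IX.prod IV) φ p v) = tnorm gM p v :=
  congrArg Real.sqrt (hφ.isometric p v v).symm

theorem isProperMap_comp_snd (hproper : IsProperMap φ) (hΓ : IsProperMap Γ) (hK : IsCompact K)
    (hφK : ∀ p, (φ p).1 ∈ K) : IsProperMap (fun p => Γ (φ p).2) := by
  rw [isProperMap_iff_isCompact_preimage]
  refine ⟨hΓ.continuous.comp (continuous_snd.comp hproper.continuous), fun A hA => ?_⟩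
  have h1 := hproper.isCompact_preimage (hK.prod (hΓ.isCompact_preimage hA))
  -- Because the projection to `X` stays in `K`, the preimage of `A` is exactly the preimage under
  -- `φ` of `K` times the preimage of `A` under `Γ`.
  convert h1 using 1
  ext p
  simp [hφK p]

/-- The estimates along a submanifold: bounds for the differential of `Γ ∘ π_V` and for its
Hessian in the warped product, outside a compact set. -/
theorem exists_bounds (hφ : IsIsometricImmersion gM (warpedMetric gX gV ψ hψ hψpos) φ)
    (hΓ : IsOYPairHessian gV h Γ) (hproper : IsProperMap φ) (hK : IsCompact K)
    (hφK : ∀ p, (φ p).1 ∈ K) :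
    ∃ a b : ℝ, 0 < a ∧ 0 < b ∧ ∃ C : Set M, IsCompact C ∧ ∀ p ∉ C,
      (∀ ξ : TangentSpace (IX.prod IV) (φ p),
        |differential (I := IX.prod IV) (Γ ∘ Prod.snd) (φ p) ξ| ≤
          a * √(Γ (φ p).2) * tnorm (warpedMetric gX gV ψ hψ hψpos) (φ p) ξ) ∧
      (∀ v : TangentSpace IM p,
        Hess (warpedMetric gX gV ψ hψ hψpos) (Γ ∘ Prod.snd) (φ p)
          (mfderiv IM (IX.prod IV) φ p v) (mfderiv IM (IX.prod IV) φ p v) ≤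
          b * √(Γ (φ p).2 * h √(Γ (φ p).2)) * gM.inner p v v) := by
  obtain ⟨s, hs, hsψ⟩ := hK.exists_forall_le' hψ.continuous.continuousOn
    (a := 0) (fun x _ => hψpos x)
  obtain ⟨L, hL, hψL⟩ := exists_abs_differential_le_of_isCompact gX hψ hK
  obtain ⟨c, hc, C₁, hC₁, hgrad⟩ := hΓ.γ_grad
  obtain ⟨c', hc', C₂, hC₂, hhess⟩ := hΓ.γ_hess
  have h0 : 0 < √(h 0) := Real.sqrt_pos.2 hΓ.h_zero
  -- The constants of `abs_differential_comp_snd_le` and `hess_comp_snd_le`, with `1 / √(h 0)` from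
  -- absorbing `√Γ`. The exceptional set is compact by properness of `φ`; off it, `φ p` lies over
  -- `K`, so its fibre component must avoid both exceptional sets of `Γ`.
  refine ⟨c / s, c' / s ^ 2 + 2 * L * c / s ^ 2 / √(h 0), by positivity, by positivity,
    φ ⁻¹' (K ×ˢ (C₁ ∪ C₂)), hproper.isCompact_preimage (hK.prod (hC₁.union hC₂)), ?_⟩
  intro p hp
  have hp' : (φ p).2 ∉ C₁ ∪ C₂ := fun hp2 => hp ⟨hφK p, hp2⟩
  have g1 := hgrad _ (fun k => hp' (Or.inl k))
  have g2 := hhess _ (fun k => hp' (Or.inr k))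
  have hsp := hsψ _ (hφK p)
  have hcn : 0 ≤ c * √(Γ (φ p).2) := by positivity
  refine ⟨fun ξ => ?_, fun v => ?_⟩
  · refine (abs_differential_comp_snd_le gX gV ψ hψ hψpos hΓ.γ_smooth hs hsp hcn g1 ξ).trans_eq ?_
    rw [mul_div_right_comm]
  · refine (hess_comp_snd_le gX gV ψ hψ hψpos hΓ.γ_smooth hs hsp hcn (by positivity) hL
      (hψL _ (hφK p)) g1 g2 _).trans ?_
    have e := (congrArg (· ^ 2) (tnorm_mfderiv hφ p v)).trans (tnorm_sq gM p v)
    refine (congrArg (_ * ·) e).trans_le ?_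
    refine mul_le_mul_of_nonneg_right ?_ (metric_nonneg gM p v)
    have k := hΓ.sqrt_le (hΓ.γ_nonneg (φ p).2)
    calc c' * √(Γ (φ p).2 * h √(Γ (φ p).2)) / s ^ 2 + 2 * L * (c * √(Γ (φ p).2)) / s ^ 2
        ≤ c' * √(Γ (φ p).2 * h √(Γ (φ p).2)) / s ^ 2 +
          2 * L * (c * (√(Γ (φ p).2 * h √(Γ (φ p).2)) / √(h 0))) / s ^ 2 := by gcongr
      _ = _ := by ring

/-- The conditions on `h` alone do not involve the manifold and carry over. The gradient bound
follows from the bound on the lifted differential because `dφ` preserves lengths. -/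
theorem isOYPrePair_comp (hφ : IsIsometricImmersion gM (warpedMetric gX gV ψ hψ hψpos) φ)
    (hΓ : IsOYPairHessian gV h Γ) (hproper : IsProperMap φ) (hK : IsCompact K)
    (hφK : ∀ p, (φ p).1 ∈ K) : IsOYPrePair gM h (Γ ∘ Prod.snd ∘ φ) where
  h_smooth := hΓ.h_smooth
  h_nonneg := hΓ.h_nonneg
  γ_smooth := hΓ.γ_smooth.comp (contMDiff_snd.comp hφ.smooth)
  γ_nonneg p := hΓ.γ_nonneg _
  h_zero := hΓ.h_zero
  h_deriv := hΓ.h_deriv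
  h_limsup := hΓ.h_limsup
  h_integral := hΓ.h_integral
  γ_proper := isProperMap_comp_snd hproper hΓ.γ_proper hK hφK
  γ_grad := by
    obtain ⟨a, b, ha, -, C, hC, hb⟩ := exists_bounds hφ hΓ hproper hK hφK
    refine ⟨a, ha, C, hC, fun p hp => ?_⟩
    refine tnorm_grad_le gM _ p (by positivity) fun v => ?_
    have h1 := (hb p hp).1 (mfderiv IM (IX.prod IV) φ p v)
    rw [tnorm_mfderiv hφ] at h1
    have hf : ContMDiff (IX.prod IV) 𝓘(ℝ, ℝ) ∞ (Γ ∘ Prod.snd : X × V → ℝ) :=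
      hΓ.γ_smooth.comp contMDiff_snd
    have h2 : mfderiv IM 𝓘(ℝ, ℝ) ((Γ ∘ Prod.snd) ∘ φ) p =
        (mfderiv (IX.prod IV) 𝓘(ℝ, ℝ) (Γ ∘ Prod.snd) (φ p)).comp (mfderiv IM (IX.prod IV) φ p) :=
      mfderiv_comp p (hf.mdifferentiable (by simp) _) (hφ.smooth.mdifferentiable (by simp) _)
    have h3 : differential (I := IM) (Γ ∘ Prod.snd ∘ φ) p v =
        differential (I := IX.prod IV) (Γ ∘ Prod.snd) (φ p) (mfderiv IM (IX.prod IV) φ p v) :=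
      congrArg (fun A : EM →L[ℝ] ℝ => A v) h2
    rw [h3]
    exact h1

theorem isOYPairHessian_comp (hφ : IsIsometricImmersion gM (warpedMetric gX gV ψ hψ hψpos) φ)
    (hΓ : IsOYPairHessian gV h Γ) (hproper : IsProperMap φ) (hK : IsCompact K)
    (hφK : ∀ p, (φ p).1 ∈ K) {α : ℝ} (hα : 0 < α) {C : Set M} (hC : IsCompact C)
    (hS : ∀ p ∉ C, ∀ e : TangentSpace IM p,
      tnorm (warpedMetric gX gV ψ hψ hψpos) (φ p)
        (secondFundamentalForm (I := IM) (warpedMetric gX gV ψ hψ hψpos) φ p e e)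
        ≤ α * √(h √(Γ (φ p).2)) * tnorm gM p e ^ 2) :
    IsOYPairHessian gM h (Γ ∘ Prod.snd ∘ φ) where
  toIsOYPrePair := isOYPrePair_comp hφ hΓ hproper hK hφK
  γ_hess := by
    obtain ⟨a, b, ha, hb, C', hC', hbd⟩ := exists_bounds hφ hΓ hproper hK hφK
    -- `b` bounds the ambient Hessian. The curvature term is at most `a √Γ` times `α √(h(√Γ)) |e|²`,
    -- whence `a * α`.
    refine ⟨b + a * α, by positivity, C ∪ C', hC.union hC', fun p hp e => ?_⟩
    have h1 := hS p (fun k => hp (Or.inl k)) e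
    obtain ⟨h2, h3⟩ := hbd p (fun k => hp (Or.inr k))
    have hf : ContMDiff (IX.prod IV) 𝓘(ℝ, ℝ) ∞ (Γ ∘ Prod.snd : X × V → ℝ) :=
      hΓ.γ_smooth.comp contMDiff_snd
    refine (hφ.hess_comp hf p e e).trans_le ?_
    have h4 := (le_abs_self _).trans (h2 (secondFundamentalForm (I := IM)
      (warpedMetric gX gV ψ hψ hψpos) φ p e e))
    rw [tnorm_sq] at h1
    have h5 : a * √(Γ (φ p).2) * tnorm (warpedMetric gX gV ψ hψ hψpos) (φ p)
        (secondFundamentalForm (I := IM) (warpedMetric gX gV ψ hψ hψpos) φ p e e) ≤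
        a * α * √(Γ (φ p).2 * h √(Γ (φ p).2)) * gM.inner p e e := by
      refine (mul_le_mul_of_nonneg_left h1 (by positivity)).trans_eq ?_
      rw [Real.sqrt_mul (hΓ.γ_nonneg _)]
      ring
    refine (add_le_add (h3 e) (h4.trans h5)).trans_eq ?_
    simp only [Function.comp_apply]
    ring

theorem isOYPairLaplacian_comp (hφ : IsIsometricImmersion gM (warpedMetric gX gV ψ hψ hψpos) φ)
    (hΓ : IsOYPairHessian gV h Γ) (hproper : IsProperMap φ) (hK : IsCompact K)
    (hφK : ∀ p, (φ p).1 ∈ K) {α : ℝ} (hα : 0 < α) {C : Set M} (hC : IsCompact C)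
    (hH : ∀ p ∉ C, tnorm (warpedMetric gX gV ψ hψ hψpos) (φ p)
        (meanCurvature gM (warpedMetric gX gV ψ hψ hψpos) φ p) ≤ α * √(h √(Γ (φ p).2))) :
    IsOYPairLaplacian gM h (Γ ∘ Prod.snd ∘ φ) where
  toIsOYPrePair := isOYPrePair_comp hφ hΓ hproper hK hφK
  γ_laplacian := by
    obtain ⟨a, b, ha, hb, C', hC', hbd⟩ := exists_bounds hφ hΓ hproper hK hφK
    -- Each vector of an orthonormal basis contributes at most `b` to the trace. This is where a
    -- bound on the full Hessian of `Γ` is needed: the images of the basis vectors have vertical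
    -- components that need not be orthonormal.
    refine ⟨Module.finrank ℝ EM * b + a * α, by positivity, C ∪ C', hC.union hC', fun p hp => ?_⟩
    have h1 := hH p (fun k => hp (Or.inl k))
    obtain ⟨h2, h3⟩ := hbd p (fun k => hp (Or.inr k))
    have hf : ContMDiff (IX.prod IV) 𝓘(ℝ, ℝ) ∞ (Γ ∘ Prod.snd : X × V → ℝ) :=
      hΓ.γ_smooth.comp contMDiff_snd
    -- By linearity of the differential, the curvature terms are collected into the mean curvature
    -- vector before any estimate, so that no bound on the individual terms is required.
    have hsum : differential (I := IX.prod IV) (Γ ∘ Prod.snd) (φ p)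
        (meanCurvature gM (warpedMetric gX gV ψ hψ hψpos) φ p) =
        ∑ i, differential (I := IX.prod IV) (Γ ∘ Prod.snd) (φ p)
          (secondFundamentalForm (I := IM) (warpedMetric gX gV ψ hψ hψpos) φ p
            (orthonormalBasis gM p i) (orthonormalBasis gM p i)) := by
      unfold meanCurvature metricTrace
      exact map_sum (differential (I := IX.prod IV) (Γ ∘ Prod.snd) (φ p)) _ _
    have hlap : laplacian gM (Γ ∘ Prod.snd ∘ φ) p =
        ∑ i, Hess (warpedMetric gX gV ψ hψ hψpos) (Γ ∘ Prod.snd) (φ p)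
          (mfderiv IM (IX.prod IV) φ p (orthonormalBasis gM p i))
          (mfderiv IM (IX.prod IV) φ p (orthonormalBasis gM p i)) +
        differential (I := IX.prod IV) (Γ ∘ Prod.snd) (φ p)
          (meanCurvature gM (warpedMetric gX gV ψ hψ hψpos) φ p) := by
      rw [hsum, ← Finset.sum_add_distrib]
      unfold laplacian metricTrace
      exact Finset.sum_congr rfl fun i _ => hφ.hess_comp hf p _ _
    have h4 := (le_abs_self _).trans (h2 (meanCurvature gM (warpedMetric gX gV ψ hψ hψpos) φ p))
    have h5 : a * √(Γ (φ p).2) * tnorm (warpedMetric gX gV ψ hψ hψpos) (φ p)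
        (meanCurvature gM (warpedMetric gX gV ψ hψ hψpos) φ p) ≤
        a * α * √(Γ (φ p).2 * h √(Γ (φ p).2)) := by
      refine (mul_le_mul_of_nonneg_left h1 (by positivity)).trans_eq ?_
      rw [Real.sqrt_mul (hΓ.γ_nonneg _)]
      ring
    have h6 : ∑ i, Hess (warpedMetric gX gV ψ hψ hψpos) (Γ ∘ Prod.snd) (φ p)
          (mfderiv IM (IX.prod IV) φ p (orthonormalBasis gM p i))
          (mfderiv IM (IX.prod IV) φ p (orthonormalBasis gM p i)) ≤
        ∑ _i : Fin (Module.finrank ℝ EM), b * √(Γ (φ p).2 * h √(Γ (φ p).2)) := by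
      refine Finset.sum_le_sum fun i _ => (h3 _).trans_eq ?_
      rw [orthonormalBasis_inner, mul_one]
    rw [Finset.sum_const, Finset.card_univ, Fintype.card_fin, nsmul_eq_mul] at h6
    rw [hlap]
    refine (add_le_add h6 (h4.trans h5)).trans_eq ?_
    simp only [Function.comp_apply]
    ring

end Submanifold

end WarpedOY

end

theorem theorem3p3
    {EM EX EV : Type*}
    [NormedAddCommGroup EM] [NormedSpace ℝ EM] [FiniteDimensional ℝ EM]
    [NormedAddCommGroup EX] [NormedSpace ℝ EX] [FiniteDimensional ℝ EX]
    [NormedAddCommGroup EV] [NormedSpace ℝ EV] [FiniteDimensional ℝ EV]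
    {M X V : Type*}
    [TopologicalSpace M] [ChartedSpace EM M] [IsManifold 𝓘(ℝ, EM) ∞ M]
    [T2Space M] [SecondCountableTopology M]
    [TopologicalSpace X] [ChartedSpace EX X] [IsManifold 𝓘(ℝ, EX) ∞ X]
    [T2Space X] [SecondCountableTopology X]
    [TopologicalSpace V] [ChartedSpace EV V] [IsManifold 𝓘(ℝ, EV) ∞ V]
    [T2Space V] [SecondCountableTopology V]
    (gM : WarpedOY.Metric 𝓘(ℝ, EM) M)
    (gX : WarpedOY.Metric 𝓘(ℝ, EX) X)
    (gV : WarpedOY.Metric 𝓘(ℝ, EV) V)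
    (ψ : X → ℝ) (hψ : ContMDiff 𝓘(ℝ, EX) 𝓘(ℝ, ℝ) ∞ ψ) (hψpos : ∀ x, 0 < ψ x)
    (φ : M → X × V)
    (hφ : WarpedOY.IsIsometricImmersion gM (WarpedOY.warpedMetric gX gV ψ hψ hψpos) φ)
    (h : ℝ → ℝ) (Γ : V → ℝ) (hΓ : WarpedOY.IsOYPairHessian gV h Γ)
    (γ : M → ℝ) (hγ : ∀ p, γ p = Γ (φ p).2)
    (hproper : IsProperMap φ)
    (hK : ∃ K : Set X, IsCompact K ∧ ∀ p, (φ p).1 ∈ K) :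
    ((∃ α : ℝ, 0 < α ∧ ∃ C : Set M, IsCompact C ∧
        ∀ p ∉ C, ∀ e : TangentSpace 𝓘(ℝ, EM) p,
          WarpedOY.tnorm (WarpedOY.warpedMetric gX gV ψ hψ hψpos) (φ p)
              (WarpedOY.secondFundamentalForm (WarpedOY.warpedMetric gX gV ψ hψ hψpos) φ p e e)
            ≤ α * √(h (√(γ p))) * WarpedOY.tnorm gM p e ^ 2) →
      WarpedOY.IsOYPairHessian gM h γ) ∧
    ((∃ α : ℝ, 0 < α ∧ ∃ C : Set M, IsCompact C ∧
        ∀ p ∉ C,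
          WarpedOY.tnorm (WarpedOY.warpedMetric gX gV ψ hψ hψpos) (φ p)
              (WarpedOY.meanCurvature gM (WarpedOY.warpedMetric gX gV ψ hψ hψpos) φ p)
            ≤ α * √(h (√(γ p)))) →
      WarpedOY.IsOYPairLaplacian gM h γ) := by
  obtain ⟨K, hK, hφK⟩ := hK
  obtain rfl : γ = Γ ∘ Prod.snd ∘ φ := funext hγ
  refine ⟨?_, ?_⟩
  · rintro ⟨α, hα, C, hC, hS⟩
    exact WarpedOY.isOYPairHessian_comp hφ hΓ hproper hK hφK hα hC hS
  · rintro ⟨α, hα, C, hC, hH⟩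
    exact WarpedOY.isOYPairLaplacian_comp hφ hΓ hproper hK hφK hα hC hH
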